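/- Let $N\in\mathbb N$. Let $C(O_N^+)$ be the universal unital $C^*$-algebra generated by elements $u_{ij}$, $1\le i,j\le N$, with the relations $u_{ij}=u_{ij}^*$ and $uu^t=u^tu=1$, where $u=(u_{ij})$, and let $C(U_N^+)$ be the universal unital $C^*$-algebra generated by elements $u_{ij}$, $1\le i,j\le N$, with the relations $uu^*=u^*u=1$ and $u^t\bar u=\bar uu^t=1$, where $\bar u=(u_{ij}^*)$. For three coordinates $a=u_{ij}$, $b=u_{kl}$, $c=u_{pq}$ put $\mathrm{span}(a,b,c)=(\#\{i,k,p\},\#\{j,l,q\})$, the numbers of rows and columns which they span. Let $C(\bar O_N^*)$ and $C(\bar U_N^{**})$ be the quotients of $C(O_N^+)$ and of $C(U_N^+)$ by the relations $$\alpha\beta\gamma=\begin{cases}-\gamma\beta\alpha&\text{if }\mathrm{span}(a,b,c)=(\le 2,3)\text{ or }(3,\le 2),\\ \gamma\beta\alpha&\text{otherwise,}\end{cases}$$ for all coordinates $a,b,c\in\{u_{ij}\}$ and all $\alpha\in\{a,a^*\}$, $\beta\in\{b,b^*\}$, $\gamma\in\{c,c^*\}$. Proposition 3.4. The above quotients define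 compact quantum groups $\bar O_N^*\subset O_N^+$ and $\bar U_N^{**}\subset U_N^+$. More precisely, let $(A,\bar A)$ be either $(C(O_N^+),C(\bar O_N^*))$ or $(C(U_N^+),C(\bar U_N^{**}))$, let $\pi:A\to\bar A$ be the quotient map, which is surjective, and denote by $u_{ij}$ also the elements $\pi(u_{ij})$ of $\bar A$. Then: 1. Each of $(A,u)$ and $(\bar A,u)$ is a compact matrix quantum group in the sense of Woronowicz: with $B$ standing for the algebra, the $*$-subalgebra $\mathcal B\subset B$ generated by the $u_{ij}$ is dense, there is a unital $*$-homomorphism $\Delta:B\to B\otimes B$ (minimal tensor product) with $\Delta(u_{ij})=\sum_ku_{ik}\otimes u_{kj}$, and there is a unital linear antimultiplicative map $\kappa:\mathcal B\to\mathcal B$ with $\kappa(\kappa(x^*)^*)=x$ for all $x\in\mathcal B$ and $\sum_k\kappa(u_{ik})u_{kj}=\sum_ku_{ik}\kappa(u_{kj})=\delta_{ij}$. 2. On each of $A$ and $\bar A$ there are unital $*$-homomorphisms $\Delta:B\to B\otimes B$, $\varepsilon:B\to\mathbb C$ and $S:B\to B^{op}$ given by $\Delta(u_{ij})=\sum_ku_{ik}\otimes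 u_{kj}$, $\varepsilon(u_{ij})=\delta_{ij}$ and $S(u_{ij})=u_{ji}^*$, and those of $A$ descend to those of $\bar A$: there is a $*$-homomorphism $\pi\otimes\pi:A\otimes A\to\bar A\otimes\bar A$ with $(\pi\otimes\pi)(a\otimes b)=\pi(a)\otimes\pi(b)$, and $\Delta_{\bar A}\,\pi=(\pi\otimes\pi)\Delta_A$, $\varepsilon_{\bar A}\,\pi=\varepsilon_A$, $S_{\bar A}\,\pi=\pi S_A$. -/

import Mathlib

open scoped TensorProduct

noncomputable section

universe u v

/-! ### C⋆-seminorms on ⋆-algebras and the associated C⋆-algebras -/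

/-- A C⋆-seminorm on a complex unital ⋆-algebra `E`. -/
structure CStarSeminorm (E : Type u) [Ring E] [StarRing E] [Algebra ℂ E] where
  /-- the underlying vector space seminorm -/
  toSeminorm : Seminorm ℂ E
  mul_le : ∀ x y, toSeminorm (x * y) ≤ toSeminorm x * toSeminorm y
  star_mul_self : ∀ x, toSeminorm (star x * x) = toSeminorm x * toSeminorm x

namespace CStarSeminorm

section Basic

variable {E : Type u} [Ring E] [StarRing E] [Algebra ℂ E]

instance : CoeFun (CStarSeminorm E) (fun _ => E → ℝ) := ⟨fun q => q.toSeminorm⟩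

theorem nonneg (q : CStarSeminorm E) (x : E) : 0 ≤ q x := apply_nonneg q.toSeminorm x

theorem le_star (q : CStarSeminorm E) (x : E) : q x ≤ q (star x) := by
  have h := q.mul_le (star x) x
  rw [q.star_mul_self] at h
  rcases (q.nonneg x).eq_or_lt with h0 | h0
  · rw [← h0]; exact q.nonneg _
  · exact le_of_mul_le_mul_right h h0

theorem star_eq (q : CStarSeminorm E) (x : E) : q (star x) = q x :=
  le_antisymm (by simpa using q.le_star (star x)) (q.le_star x)

theorem one_le_one (q : CStarSeminorm E) : q 1 ≤ 1 := by
  have h := q.star_mul_self 1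
  simp only [star_one, mul_one] at h
  nlinarith [q.nonneg 1]

/-- The pointwise supremum of a pointwise bounded set of C⋆-seminorms. -/
def sup (S : Set (CStarSeminorm E)) (hS : ∀ x, ∃ C : ℝ, ∀ q ∈ S, q x ≤ C) : CStarSeminorm E :=
  have hb : ∀ x, BddAbove (Set.range fun q : S => q.1 x) := fun x => by
    obtain ⟨C, hC⟩ := hS x
    exact ⟨C, by rintro _ ⟨q, rfl⟩; exact hC q.1 q.2⟩
  have h0 : ∀ x, 0 ≤ ⨆ q : S, q.1 x := fun x => Real.iSup_nonneg fun q => q.1.nonneg x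
  have hmul : ∀ x y, (⨆ q : S, q.1 (x * y)) ≤ (⨆ q : S, q.1 x) * ⨆ q : S, q.1 y := fun x y =>
    Real.iSup_le (fun q => (q.1.mul_le x y).trans
      (mul_le_mul (le_ciSup (hb x) q) (le_ciSup (hb y) q) (q.1.nonneg y) (h0 x)))
      (mul_nonneg (h0 x) (h0 y))
  have hstar : ∀ x, (⨆ q : S, q.1 (star x)) = ⨆ q : S, q.1 x := fun x => by simp only [star_eq]
  { toSeminorm := Seminorm.of (fun x => ⨆ q : S, q.1 x)
      (fun x y => Real.iSup_le (fun q => (map_add_le_add q.1.toSeminorm x y).trans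
        (add_le_add (le_ciSup (hb x) q) (le_ciSup (hb y) q))) (add_nonneg (h0 x) (h0 y)))
      (fun c x => by
        simp only [map_smul_eq_mul]
        rw [Real.mul_iSup_of_nonneg (norm_nonneg c)])
    mul_le := hmul
    star_mul_self := fun x => by
      refine le_antisymm ?_ ?_
      · have := hmul (star x) x
        rw [hstar] at this
        exact this
      · change (⨆ q : S, q.1 x) * (⨆ q : S, q.1 x) ≤ ⨆ q : S, q.1 (star x * x)
        rw [← sq, ← Real.le_sqrt (h0 x) (h0 _)]
        refine Real.iSup_le (fun q => Real.le_sqrt_of_sq_le ?_) (Real.sqrt_nonneg _)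
        rw [sq, ← q.1.star_mul_self]
        exact le_ciSup (hb (star x * x)) q }

theorem sup_apply (S : Set (CStarSeminorm E)) (hS : ∀ x, ∃ C : ℝ, ∀ q ∈ S, q x ≤ C) (x : E) :
    sup S hS x = ⨆ q : S, q.1 x := rfl

/-- The algebra `E`, to be equipped with the C⋆-seminorm `q`. -/
def Carrier (_ : CStarSeminorm E) : Type u := E

instance (q : CStarSeminorm E) : Ring q.Carrier := inferInstanceAs (Ring E)
instance (q : CStarSeminorm E) : StarRing q.Carrier := inferInstanceAs (StarRing E)
instance (q : CStarSeminorm E) : Algebra ℂ q.Carrier := inferInstanceAs (Algebra ℂ E)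
instance [StarModule ℂ E] (q : CStarSeminorm E) : StarModule ℂ q.Carrier :=
  inferInstanceAs (StarModule ℂ E)

instance (q : CStarSeminorm E) : SeminormedRing q.Carrier :=
  { (inferInstance : Ring q.Carrier),
    q.toSeminorm.toAddGroupSeminorm.toSeminormedAddCommGroup with
    norm_mul_le := q.mul_le }

instance (q : CStarSeminorm E) : NormedAlgebra ℂ q.Carrier where
  toAlgebra := inferInstance
  norm_smul_le c x := (q.toSeminorm.smul' c x).le

/-- The Hausdorff completion of `E` with respect to the C⋆-seminorm `q`. -/
def Completion (q : CStarSeminorm E) : Type u := UniformSpace.Completion q.Carrier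

theorem norm_carrier (q : CStarSeminorm E) (x : q.Carrier) : ‖x‖ = q x := rfl

end Basic

section Completion

variable {E : Type u} [Ring E] [StarRing E] [Algebra ℂ E] (q : CStarSeminorm E)

instance : NormedRing q.Completion :=
  inferInstanceAs (NormedRing (UniformSpace.Completion q.Carrier))

instance : CompleteSpace q.Completion :=
  inferInstanceAs (CompleteSpace (UniformSpace.Completion q.Carrier))

instance : Algebra ℂ q.Completion :=
  inferInstanceAs (Algebra ℂ (UniformSpace.Completion q.Carrier))

instance : NormedAlgebra ℂ q.Completion where
  toAlgebra := inferInstance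
  norm_smul_le c x := by
    have h : ∀ y : UniformSpace.Completion q.Carrier, ‖c • y‖ ≤ ‖c‖ * ‖y‖ := norm_smul_le c
    exact h x

/-- The canonical map from `E` to its completion, as a function. -/
def coe (x : E) : q.Completion := UniformSpace.Completion.coe' (α := q.Carrier) x

theorem norm_coe (x : E) : ‖q.coe x‖ = q x :=
  UniformSpace.Completion.norm_coe (E := q.Carrier) x

theorem denseRange_coe : DenseRange q.coe :=
  UniformSpace.Completion.denseRange_coe (α := q.Carrier)

theorem induction {p : q.Completion → Prop} (hp : IsClosed {x | p x}) (h : ∀ x, p (q.coe x))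
    (x : q.Completion) : p x :=
  UniformSpace.Completion.induction_on (α := q.Carrier) x hp h

theorem uniformContinuous_star : UniformContinuous (star : q.Carrier → q.Carrier) := by
  refine Isometry.uniformContinuous (Isometry.of_dist_eq fun x y => ?_)
  rw [dist_eq_norm, dist_eq_norm]
  have h : ‖star (x - y)‖ = ‖x - y‖ := q.star_eq (x - y)
  have h2 : star x - star y = star (x - y) := (star_sub x y).symm
  rw [h2]
  exact h

instance : Star q.Completion :=
  ⟨UniformSpace.Completion.map (star : q.Carrier → q.Carrier)⟩

theorem coe_star (x : E) : q.coe (star x) = star (q.coe x) :=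
  (UniformSpace.Completion.map_coe q.uniformContinuous_star x).symm

theorem coe_add (x y : E) : q.coe (x + y) = q.coe x + q.coe y :=
  UniformSpace.Completion.coe_add (α := q.Carrier) x y

theorem coe_mul (x y : E) : q.coe (x * y) = q.coe x * q.coe y :=
  UniformSpace.Completion.coe_mul (α := q.Carrier) x y

theorem coe_smul (c : ℂ) (x : E) : q.coe (c • x) = c • q.coe x :=
  UniformSpace.Completion.coe_smul (X := q.Carrier) c x

theorem coe_one : q.coe 1 = 1 := rfl

theorem continuous_star : Continuous (star : q.Completion → q.Completion) :=
  UniformSpace.Completion.continuous_map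

instance : StarRing q.Completion :=
  have hs := q.continuous_star
  { star_involutive := q.induction
      (isClosed_eq (hs.comp hs) continuous_id) fun x => by rw [← coe_star, ← coe_star, star_star]
    star_mul := fun x y => by
      revert x
      refine q.induction (isClosed_eq (hs.comp (continuous_id.mul continuous_const))
        (continuous_const.mul hs)) fun x => ?_
      revert y
      refine q.induction (isClosed_eq (hs.comp (continuous_const.mul continuous_id))
        (hs.mul continuous_const)) fun y => ?_
      simp only [← coe_star, ← coe_mul, star_mul]
    star_add := fun x y => by
      revert x
      refine q.induction (isClosed_eq (hs.comp (continuous_id.add continuous_const))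
        (hs.add continuous_const)) fun x => ?_
      revert y
      refine q.induction (isClosed_eq (hs.comp (continuous_const.add continuous_id))
        (continuous_const.add hs)) fun y => ?_
      simp only [← coe_star, ← coe_add, star_add] }

instance : CStarRing q.Completion where
  norm_mul_self_le := q.induction (isClosed_le (continuous_norm.mul continuous_norm)
      (continuous_norm.comp (q.continuous_star.mul continuous_id))) fun x => by
    rw [← coe_star, ← coe_mul, norm_coe, norm_coe, q.star_mul_self]

/-- The canonical ⋆-homomorphism from `E` to its completion. -/
def toCompletion : E →⋆ₐ[ℂ] q.Completion where
  toFun := q.coe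
  map_one' := q.coe_one
  map_mul' := q.coe_mul
  map_zero' := UniformSpace.Completion.coe_zero (α := q.Carrier)
  map_add' := q.coe_add
  commutes' c := by
    rw [Algebra.algebraMap_eq_smul_one, coe_smul, coe_one, Algebra.algebraMap_eq_smul_one]
  map_star' := q.coe_star

theorem norm_toCompletion (x : E) : ‖q.toCompletion x‖ = q x := q.norm_coe x

theorem denseRange_toCompletion : DenseRange q.toCompletion := q.denseRange_coe

variable [StarModule ℂ E]

instance : StarModule ℂ q.Completion where
  star_smul c := q.induction (isClosed_eq (q.continuous_star.comp (continuous_const_smul c))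
      (q.continuous_star.const_smul (star c))) fun x => by
    simp only [← coe_star, ← coe_smul, star_smul]

/-- The Hausdorff completion of a ⋆-algebra in a C⋆-seminorm is a unital C⋆-algebra. -/
instance : CStarAlgebra q.Completion where

end Completion

/-- Every C⋆-seminorm on a C⋆-algebra is bounded by the norm. -/
theorem le_norm {A : Type u} [CStarAlgebra A] (q : CStarSeminorm A) (x : A) : q x ≤ ‖x‖ := by
  rw [← q.norm_toCompletion]
  exact NonUnitalStarAlgHom.norm_apply_le q.toCompletion x

end CStarSeminorm

/-! ### Universal C⋆-algebras defined by relations -/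

section Presented

variable (E : Type u) [Ring E] [StarRing E] [Algebra ℂ E]

/-- The C⋆-seminorms on `E` for which all the elements of `R` have seminorm zero, i.e. those which
come from ⋆-homomorphisms of `E` into C⋆-algebras in which the relations `r = 0`, `r ∈ R`, hold. -/
def relationSeminorms (R : Set E) : Set (CStarSeminorm E) := {q | ∀ r ∈ R, q r = 0}

/-- The condition for the universal C⋆-algebra to exist: in the C⋆-algebras in which the relations
hold, the image of any given `x : E` is bounded in norm by a constant. -/
def HasBoundedRelations (R : Set E) : Prop :=
  ∀ x : E, ∃ C : ℝ, ∀ q ∈ relationSeminorms E R, q x ≤ C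

variable {E}

/-- The largest C⋆-seminorm on `E` which vanishes on `R`. -/
def relationSeminorm (R : Set E) (hR : HasBoundedRelations E R) : CStarSeminorm E :=
  CStarSeminorm.sup (relationSeminorms E R) fun x => hR x

theorem relationSeminorm_apply (R : Set E) (hR : HasBoundedRelations E R) (x : E) :
    relationSeminorm R hR x = ⨆ q : relationSeminorms E R, q.1 x := rfl

/-- The universal C⋆-algebra generated by the ⋆-algebra `E`, with the relations `r = 0` for
`r ∈ R`: the Hausdorff completion of `E` with respect to the largest C⋆-seminorm which vanishes on
`R`. When `E` is a free ⋆-algebra this is the C⋆-algebra with given generators and relations;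
when `E` is itself a C⋆-algebra this is the quotient of `E` by the closed two-sided ideal
generated by `R`. -/
abbrev UniversalCStar (R : Set E) (hR : HasBoundedRelations E R) : Type u :=
  (relationSeminorm R hR).Completion

/-- The canonical map to the universal C⋆-algebra. -/
def UniversalCStar.mk (R : Set E) (hR : HasBoundedRelations E R) :
    E →⋆ₐ[ℂ] UniversalCStar R hR :=
  (relationSeminorm R hR).toCompletion

end Presented

/-- In a C⋆-algebra, any set of relations may be imposed. -/
theorem hasBoundedRelations_of_cstarAlgebra {A : Type u} [CStarAlgebra A] (R : Set A) :
    HasBoundedRelations A R := fun x => ⟨‖x‖, fun q _ => q.le_norm x⟩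

/-! ### Free ⋆-algebras -/

/-- The free complex unital ⋆-algebra on the set `I`: noncommutative polynomials in the variables
`gen i` (the left copy of `I`) and their adjoints `star (gen i)` (the right copy of `I`). -/
def FreeStarAlgebra (I : Type u) : Type u := FreeAlgebra ℂ (I ⊕ I)

namespace FreeStarAlgebra

variable {I : Type u}

instance : Ring (FreeStarAlgebra I) := inferInstanceAs (Ring (FreeAlgebra ℂ (I ⊕ I)))
instance : Algebra ℂ (FreeStarAlgebra I) := inferInstanceAs (Algebra ℂ (FreeAlgebra ℂ (I ⊕ I)))

/-- The generators. -/
def gen (i : I) : FreeStarAlgebra I := FreeAlgebra.ι ℂ (Sum.inl i)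

/-- The opposite of the free algebra, with the complex conjugate scalar multiplication. -/
def ConjOp (I : Type u) : Type u := (FreeAlgebra ℂ (I ⊕ I))ᵐᵒᵖ

instance : Ring (ConjOp I) := inferInstanceAs (Ring (FreeAlgebra ℂ (I ⊕ I))ᵐᵒᵖ)

instance : Algebra ℂ (ConjOp I) :=
  ((algebraMap ℂ (FreeAlgebra ℂ (I ⊕ I))ᵐᵒᵖ).comp (starRingEnd ℂ)).toAlgebra' fun c x =>
    Algebra.commutes (A := (FreeAlgebra ℂ (I ⊕ I))ᵐᵒᵖ) (starRingEnd ℂ c) x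

/-- The conjugate-linear antiautomorphism of the free algebra which exchanges each generator with
its adjoint, as a homomorphism to the conjugate opposite algebra. -/
def starHom (I : Type u) : FreeAlgebra ℂ (I ⊕ I) →ₐ[ℂ] ConjOp I :=
  FreeAlgebra.lift ℂ fun s => MulOpposite.op (FreeAlgebra.ι ℂ s.swap)

instance : Star (FreeStarAlgebra I) := ⟨fun x => MulOpposite.unop (starHom I x)⟩

theorem star_def (x : FreeStarAlgebra I) : star x = MulOpposite.unop (starHom I x) := rfl

/-- The generators and their adjoints. -/
def letter (s : I ⊕ I) : FreeStarAlgebra I := FreeAlgebra.ι ℂ s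

theorem star_letter (s : I ⊕ I) : star (letter s) = letter s.swap :=
  congrArg MulOpposite.unop (FreeAlgebra.lift_ι_apply (R := ℂ) (X := I ⊕ I) (A := ConjOp I)
    (fun t : I ⊕ I => MulOpposite.op (FreeAlgebra.ι ℂ t.swap)) s)

theorem star_algebraMap' (c : ℂ) :
    star (algebraMap ℂ (FreeStarAlgebra I) c) = algebraMap ℂ _ (star c) :=
  congrArg MulOpposite.unop ((starHom I).commutes c)

theorem star_mul' (x y : FreeStarAlgebra I) : star (x * y) = star y * star x :=
  congrArg MulOpposite.unop (map_mul (starHom I) x y)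

theorem star_add' (x y : FreeStarAlgebra I) : star (x + y) = star x + star y :=
  congrArg MulOpposite.unop (map_add (starHom I) x y)

theorem induction {p : FreeStarAlgebra I → Prop} (hc : ∀ c, p (algebraMap ℂ _ c))
    (hι : ∀ s : I ⊕ I, p (letter s))
    (hmul : ∀ x y, p x → p y → p (x * y)) (hadd : ∀ x y, p x → p y → p (x + y))
    (x : FreeStarAlgebra I) : p x :=
  FreeAlgebra.induction (motive := p) ℂ (I ⊕ I) hc hι hmul hadd x

instance : StarRing (FreeStarAlgebra I) where
  star_involutive x := by
    induction x using induction with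
    | hc c => rw [star_algebraMap', star_algebraMap', star_star]
    | hι s => rw [star_letter, star_letter, Sum.swap_swap]
    | hmul x y hx hy => rw [star_mul', star_mul', hx, hy]
    | hadd x y hx hy => rw [star_add', star_add', hx, hy]
  star_mul := star_mul'
  star_add := star_add'

instance : StarModule ℂ (FreeStarAlgebra I) where
  star_smul c x := by
    rw [Algebra.smul_def, star_mul, star_algebraMap', ← Algebra.commutes, ← Algebra.smul_def]

/-- Relations which force the generators to have norm at most one define a C⋆-algebra. -/
theorem hasBoundedRelations (R : Set (FreeStarAlgebra I))
    (h : ∀ q ∈ relationSeminorms (FreeStarAlgebra I) R, ∀ i : I, q (gen i) ≤ 1) :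
    HasBoundedRelations (FreeStarAlgebra I) R := by
  intro x
  induction x using induction with
  | hc c =>
    refine ⟨‖c‖, fun q _ => ?_⟩
    rw [Algebra.algebraMap_eq_smul_one, map_smul_eq_mul]
    exact mul_le_of_le_one_right (norm_nonneg c) q.one_le_one
  | hι s =>
    refine ⟨1, fun q hq => ?_⟩
    rcases s with i | i
    · exact h q hq i
    · rw [← q.star_eq, star_letter]
      exact h q hq i
  | hmul x y hx hy =>
    obtain ⟨C, hC⟩ := hx
    obtain ⟨D, hD⟩ := hy
    exact ⟨C * D, fun q hq => (q.mul_le x y).trans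
      (mul_le_mul (hC q hq) (hD q hq) (q.nonneg y) ((q.nonneg x).trans (hC q hq)))⟩
  | hadd x y hx hy =>
    obtain ⟨C, hC⟩ := hx
    obtain ⟨D, hD⟩ := hy
    exact ⟨C + D, fun q hq => (map_add_le_add q.toSeminorm x y).trans
      (add_le_add (hC q hq) (hD q hq))⟩

end FreeStarAlgebra

/-! ### The minimal tensor product of C⋆-algebras -/

section MinTensor

variable (A : Type u) (B : Type v) [CStarAlgebra A] [CStarAlgebra B]

/-- The tensor product `π ⊗ ρ` of two representations, on the (algebraic, hence possibly
incomplete) tensor product of the Hilbert spaces. -/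
def tensorRep {A : Type u} {B : Type v} [CStarAlgebra A] [CStarAlgebra B]
    {H : Type u} [NormedAddCommGroup H] [InnerProductSpace ℂ H] [CompleteSpace H]
    {K : Type v} [NormedAddCommGroup K] [InnerProductSpace ℂ K] [CompleteSpace K]
    (π : A →⋆ₐ[ℂ] (H →L[ℂ] H)) (ρ : B →⋆ₐ[ℂ] (K →L[ℂ] K)) :
    A ⊗[ℂ] B →ₐ[ℂ] (H ⊗[ℂ] K →L[ℂ] H ⊗[ℂ] K) :=
  Algebra.TensorProduct.algHomOfLinearMapTensorProduct
    (TensorProduct.lift (LinearMap.mk₂ ℂ (fun a b => TensorProduct.mapL (π a) (ρ b))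
      (fun a a' b => by rw [map_add, TensorProduct.mapL_add_left])
      (fun c a b => by rw [map_smul, TensorProduct.mapL_smul_left])
      (fun a b b' => by rw [map_add, TensorProduct.mapL_add_right])
      (fun c a b => by rw [map_smul, TensorProduct.mapL_smul_right])))
    (fun a a' b b' => by
      simp only [TensorProduct.lift.tmul, LinearMap.mk₂_apply, map_mul]
      exact TensorProduct.mapL_mul _ _ _ _)
    (by
      simp only [TensorProduct.lift.tmul, LinearMap.mk₂_apply, map_one]
      exact TensorProduct.mapL_id_id)

section

variable {A B}
variable {H : Type u} [NormedAddCommGroup H] [InnerProductSpace ℂ H] [CompleteSpace H]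
  {K : Type v} [NormedAddCommGroup K] [InnerProductSpace ℂ K] [CompleteSpace K]
  (π : A →⋆ₐ[ℂ] (H →L[ℂ] H)) (ρ : B →⋆ₐ[ℂ] (K →L[ℂ] K))

theorem tensorRep_tmul (a : A) (b : B) :
    tensorRep π ρ (a ⊗ₜ b) = TensorProduct.mapL (π a) (ρ b) := rfl

theorem tensorRep_inner (x : A ⊗[ℂ] B) (ξ η : H ⊗[ℂ] K) :
    inner ℂ (tensorRep π ρ x ξ) η = inner ℂ ξ (tensorRep π ρ (star x) η) := by
  induction x using TensorProduct.induction_on with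
  | zero => simp
  | add x y hx hy => simp [inner_add_left, inner_add_right, hx, hy]
  | tmul a b =>
    rw [TensorProduct.star_tmul, tensorRep_tmul, tensorRep_tmul, map_star, map_star]
    induction ξ using TensorProduct.induction_on with
    | zero => simp
    | add ξ ξ' h h' => rw [map_add, inner_add_left, inner_add_left, h, h']
    | tmul ξ₁ ξ₂ =>
      induction η using TensorProduct.induction_on with
      | zero => simp
      | add η η' h h' => rw [map_add, inner_add_right, inner_add_right, h, h']
      | tmul η₁ η₂ =>
        rw [TensorProduct.mapL_tmul, TensorProduct.mapL_tmul, TensorProduct.inner_tmul,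
          TensorProduct.inner_tmul, ContinuousLinearMap.star_eq_adjoint,
          ContinuousLinearMap.star_eq_adjoint, ContinuousLinearMap.adjoint_inner_right,
          ContinuousLinearMap.adjoint_inner_right]

theorem tensorRep_norm_mul_le (x : A ⊗[ℂ] B) :
    ‖tensorRep π ρ x‖ * ‖tensorRep π ρ x‖ ≤ ‖tensorRep π ρ (star x * x)‖ := by
  rw [← sq, ← Real.le_sqrt (ContinuousLinearMap.opNorm_nonneg _)
    (ContinuousLinearMap.opNorm_nonneg _)]
  refine ContinuousLinearMap.opNorm_le_bound _ (Real.sqrt_nonneg _) fun ξ => ?_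
  refine abs_le_of_sq_le_sq' ?_ (by positivity) |>.2
  rw [mul_pow, Real.sq_sqrt (ContinuousLinearMap.opNorm_nonneg _), ← inner_self_eq_norm_sq (𝕜 := ℂ), tensorRep_inner]
  have h := norm_inner_le_norm (𝕜 := ℂ) ξ (tensorRep π ρ (star x) (tensorRep π ρ x ξ))
  refine (RCLike.re_le_norm _).trans (h.trans ?_)
  have h' : tensorRep π ρ (star x) (tensorRep π ρ x ξ) = tensorRep π ρ (star x * x) ξ := by
    rw [map_mul]
    rfl
  rw [h']
  have := (tensorRep π ρ (star x * x)).le_opNorm ξ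
  nlinarith [norm_nonneg ξ]

theorem tensorRep_norm_mul (x y : A ⊗[ℂ] B) :
    ‖tensorRep π ρ (x * y)‖ ≤ ‖tensorRep π ρ x‖ * ‖tensorRep π ρ y‖ := by
  rw [map_mul]
  exact ContinuousLinearMap.opNorm_comp_le _ _

theorem tensorRep_norm_le_star (x : A ⊗[ℂ] B) :
    ‖tensorRep π ρ x‖ ≤ ‖tensorRep π ρ (star x)‖ := by
  have h := (tensorRep_norm_mul_le π ρ x).trans (tensorRep_norm_mul π ρ (star x) x)
  rcases (ContinuousLinearMap.opNorm_nonneg (tensorRep π ρ x)).eq_or_lt with h0 | h0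
  · rw [← h0]; exact ContinuousLinearMap.opNorm_nonneg _
  · exact le_of_mul_le_mul_right h h0

/-- The C⋆-seminorm `x ↦ ‖(π ⊗ ρ)(x)‖` on the algebraic tensor product. -/
def spatialSeminorm : CStarSeminorm (A ⊗[ℂ] B) where
  toSeminorm := Seminorm.ofSMulLE (fun x => ‖tensorRep π ρ x‖)
    (by rw [map_zero]; exact ContinuousLinearMap.opNorm_zero)
    (fun x y => by rw [map_add]; exact ContinuousLinearMap.opNorm_add_le _ _)
    (fun c x => by rw [map_smul]; exact ContinuousLinearMap.opNorm_smul_le c _)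
  mul_le x y := tensorRep_norm_mul π ρ x y
  star_mul_self x := by
    refine le_antisymm ?_ (tensorRep_norm_mul_le π ρ x)
    refine (tensorRep_norm_mul π ρ (star x) x).trans
      (mul_le_mul_of_nonneg_right ?_ (ContinuousLinearMap.opNorm_nonneg _))
    have h := tensorRep_norm_le_star π ρ (star x)
    rwa [star_star] at h

theorem spatialSeminorm_apply (x : A ⊗[ℂ] B) : spatialSeminorm π ρ x = ‖tensorRep π ρ x‖ := rfl

end

/-- The C⋆-seminorms `x ↦ ‖(π ⊗ ρ)(x)‖`, for all the representations `π` of `A` and `ρ` of `B` on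
Hilbert spaces. -/
def spatialSeminorms : Set (CStarSeminorm (A ⊗[ℂ] B)) :=
  {q | ∃ (H : Type u) (_ : NormedAddCommGroup H) (_ : InnerProductSpace ℂ H) (_ : CompleteSpace H)
    (K : Type v) (_ : NormedAddCommGroup K) (_ : InnerProductSpace ℂ K) (_ : CompleteSpace K)
    (π : A →⋆ₐ[ℂ] (H →L[ℂ] H)) (ρ : B →⋆ₐ[ℂ] (K →L[ℂ] K)), q = spatialSeminorm π ρ}

theorem spatialSeminorms_bounded (x : A ⊗[ℂ] B) :
    ∃ C : ℝ, ∀ q ∈ spatialSeminorms A B, q x ≤ C := by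
  induction x using TensorProduct.induction_on with
  | zero => exact ⟨0, fun q _ => (map_zero q.toSeminorm).le⟩
  | add x y hx hy =>
    obtain ⟨C, hC⟩ := hx
    obtain ⟨D, hD⟩ := hy
    exact ⟨C + D, fun q hq => (map_add_le_add q.toSeminorm x y).trans
      (add_le_add (hC q hq) (hD q hq))⟩
  | tmul a b =>
    refine ⟨‖a‖ * ‖b‖, ?_⟩
    rintro _ ⟨H, _, _, _, K, _, _, _, π, ρ, rfl⟩
    rw [spatialSeminorm_apply, tensorRep_tmul]
    exact (TensorProduct.norm_mapL_le _ _).trans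
      (mul_le_mul (NonUnitalStarAlgHom.norm_apply_le π a) (NonUnitalStarAlgHom.norm_apply_le ρ b)
        (norm_nonneg _) (norm_nonneg _))

/-- The minimal (spatial) C⋆-norm on the algebraic tensor product. -/
def minSeminorm : CStarSeminorm (A ⊗[ℂ] B) :=
  CStarSeminorm.sup (spatialSeminorms A B) (spatialSeminorms_bounded A B)

/-- The minimal (spatial) tensor product of two C⋆-algebras. -/
abbrev MinTensor : Type (max u v) := (minSeminorm A B).Completion

variable {A B}

/-- The elementary tensors in the minimal tensor product. -/
def minTmul (a : A) (b : B) : MinTensor A B := (minSeminorm A B).toCompletion (a ⊗ₜ b)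

end MinTensor

/-! ### Compact matrix quantum groups -/

section QuantumGroups

variable {n : Type}

/-- The ⋆-subalgebra generated by the entries of a matrix. -/
def coordinateAlgebra {A : Type u} [CStarAlgebra A] (w : Matrix n n A) : StarSubalgebra ℂ A :=
  StarAlgebra.adjoin ℂ (Set.range fun p : n × n => w p.1 p.2)

theorem mem_coordinateAlgebra {A : Type u} [CStarAlgebra A] (w : Matrix n n A) (i j : n) :
    w i j ∈ coordinateAlgebra w := StarAlgebra.subset_adjoin ℂ _ ⟨(i, j), rfl⟩

/-- The entries of `w`, as elements of the ⋆-subalgebra which they generate. -/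
def coordinate {A : Type u} [CStarAlgebra A] (w : Matrix n n A) (i j : n) : coordinateAlgebra w :=
  ⟨w i j, mem_coordinateAlgebra w i j⟩

variable [Fintype n] [DecidableEq n]

/-- Compact matrix quantum groups in the sense of Woronowicz: `A`, thought of as the algebra of
continuous functions, is a unital C⋆-algebra, and `w` is a square matrix over `A` such that the
⋆-algebra generated by the entries of `w` is dense, there is a comultiplication, and there is an
antipode `κ`, a linear antimultiplicative map on the ⋆-algebra generated by the entries with
`κ(κ(a*)*) = a` and `κ(w) = w⁻¹`. -/
structure IsCompactMatrixQuantumGroup {A : Type u} [CStarAlgebra A] (w : Matrix n n A) :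
    Prop where
  dense : Dense (coordinateAlgebra w : Set A)
  exists_comul : ∃ Δ : A →⋆ₐ[ℂ] MinTensor A A, ∀ i j, Δ (w i j) = ∑ k, minTmul (w i k) (w k j)
  exists_antipode : ∃ κ : coordinateAlgebra w →ₐ[ℂ] (coordinateAlgebra w)ᵐᵒᵖ,
    (∀ a, MulOpposite.unop (κ (star (MulOpposite.unop (κ (star a))))) = a) ∧
    (∀ i j, ∑ k, MulOpposite.unop (κ (coordinate w i k)) * coordinate w k j =
      if i = j then 1 else 0) ∧
    (∀ i j, ∑ k, coordinate w i k * MulOpposite.unop (κ (coordinate w k j)) =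
      if i = j then 1 else 0)

/-- Hopf algebra maps for a matrix `w` over a C⋆-algebra `A`: morphisms of C⋆-algebras
`Δ : A → A ⊗ A`, `ε : A → ℂ`, `S : A → Aᵒᵖ` with `Δ(w_ij) = ∑_k w_ik ⊗ w_kj`, `ε(w_ij) = δ_ij` and
`S(w_ij) = w_ji*`. -/
structure HopfMaps {A : Type u} [CStarAlgebra A] (w : Matrix n n A) where
  /-- the comultiplication -/
  comul : A →⋆ₐ[ℂ] MinTensor A A
  /-- the counit -/
  counit : A →⋆ₐ[ℂ] ℂ
  /-- the antipode -/
  antipode : A →⋆ₐ[ℂ] Aᵐᵒᵖ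
  comul_apply : ∀ i j, comul (w i j) = ∑ k, minTmul (w i k) (w k j)
  counit_apply : ∀ i j, counit (w i j) = if i = j then 1 else 0
  antipode_apply : ∀ i j, antipode (w i j) = MulOpposite.op (star (w j i))

/-- The Hopf algebra maps `D` over `A` descend to the Hopf algebra maps `D'` over `A'` through the
morphism `π : A → A'`, that is `Δ'π = (π ⊗ π)Δ`, `ε'π = ε` and `S'π = πS`. -/
structure HopfMaps.DescendsTo {A : Type u} [CStarAlgebra A] {w : Matrix n n A} (D : HopfMaps w)
    {A' : Type v} [CStarAlgebra A'] {w' : Matrix n n A'} (D' : HopfMaps w') (π : A →⋆ₐ[ℂ] A') :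
    Prop where
  comul : ∃ ππ : MinTensor A A →⋆ₐ[ℂ] MinTensor A' A',
    (∀ a b, ππ (minTmul a b) = minTmul (π a) (π b)) ∧
    ∀ a, D'.comul (π a) = ππ (D.comul a)
  counit : ∀ a, D'.counit (π a) = D.counit a
  antipode : ∀ a, D'.antipode (π a) = MulOpposite.op (π (MulOpposite.unop (D.antipode a)))

/-! ### The free quantum groups -/

/-- The matrix of generators of the free ⋆-algebra. -/
def genMatrix (N : ℕ) : Matrix (Fin N) (Fin N) (FreeStarAlgebra (Fin N × Fin N)) :=
  Matrix.of fun i j => FreeStarAlgebra.gen (i, j)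

/-- The set of entries of a matrix. -/
def entries {R : Type u} (M : Matrix n n R) : Set R := {x | ∃ i j, x = M i j}

/-- The relations `u_ij = u_ij*`, `u uᵗ = uᵗ u = 1`. -/
def freeOrthogonalRelations (N : ℕ) : Set (FreeStarAlgebra (Fin N × Fin N)) :=
  let U := genMatrix N
  entries (U - U.map star) ∪ entries (U * U.transpose - 1) ∪ entries (U.transpose * U - 1)

/-- The relations `u u* = u* u = 1` and `uᵗ ū = ū uᵗ = 1`. -/
def freeUnitaryRelations (N : ℕ) : Set (FreeStarAlgebra (Fin N × Fin N)) :=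
  let U := genMatrix N
  entries (U * U.conjTranspose - 1) ∪ entries (U.conjTranspose * U - 1) ∪
    entries (U.transpose * U.map star - 1) ∪ entries (U.map star * U.transpose - 1)

/-- In a C⋆-algebra, if `∑_k w_k w_k* = 1` then each `w_k` has norm at most one. -/
theorem norm_le_one_of_sum_eq_one {m : Type} [Fintype m] {B : Type u} [CStarAlgebra B] (w : m → B)
    (h : ∑ k, w k * star (w k) = 1) (j : m) : ‖w j‖ ≤ 1 := by
  let _ : PartialOrder B := CStarAlgebra.spectralOrder B
  have _ : StarOrderedRing B := CStarAlgebra.spectralOrderedRing B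
  have h1 : w j * star (w j) ≤ 1 := by
    rw [← h]
    exact Finset.single_le_sum (f := fun k => w k * star (w k))
      (fun k _ => mul_star_self_nonneg (w k)) (Finset.mem_univ j)
  have h2 := CStarAlgebra.norm_le_norm_of_nonneg_of_le (mul_star_self_nonneg (w j)) h1
  rw [CStarRing.norm_self_mul_star] at h2
  have h3 : ‖(1 : B)‖ ≤ 1 := by
    have h4 := CStarRing.norm_star_mul_self (x := (1 : B))
    rw [star_one, mul_one] at h4
    nlinarith [norm_nonneg (1 : B)]
  nlinarith [norm_nonneg (w j)]

theorem freeOrthogonal_bounded (N : ℕ) :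
    HasBoundedRelations _ (freeOrthogonalRelations N) := by
  refine FreeStarAlgebra.hasBoundedRelations _ fun q hq i => ?_
  obtain ⟨i, j⟩ := i
  have hz : ∀ x ∈ freeOrthogonalRelations N, q.toCompletion x = 0 := fun x hx => by
    rw [← norm_eq_zero, q.norm_toCompletion, hq x hx]
  have hsa : ∀ i j, q.toCompletion (genMatrix N i j) = star (q.toCompletion (genMatrix N i j)) := fun i j => by
    have := hz ((genMatrix N - (genMatrix N).map star) i j) (Or.inl (Or.inl ⟨i, j, rfl⟩))
    rw [Matrix.sub_apply, Matrix.map_apply, map_sub, map_star] at this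
    exact sub_eq_zero.1 this
  have hone := hz _ (Or.inl (Or.inr ⟨i, i, rfl⟩))
  rw [Matrix.sub_apply, Matrix.mul_apply, Matrix.one_apply_eq, map_sub, map_one, map_sum] at hone
  rw [← q.norm_toCompletion]
  refine norm_le_one_of_sum_eq_one (fun k => q.toCompletion (genMatrix N i k)) ?_ j
  rw [← sub_eq_zero.1 hone]
  exact Finset.sum_congr rfl fun k _ => by
    rw [← hsa, Matrix.transpose_apply, map_mul]

theorem freeUnitary_bounded (N : ℕ) :
    HasBoundedRelations _ (freeUnitaryRelations N) := by
  refine FreeStarAlgebra.hasBoundedRelations _ fun q hq i => ?_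
  obtain ⟨i, j⟩ := i
  have hone : q.toCompletion ((genMatrix N * (genMatrix N).conjTranspose - 1) i i) = 0 := by
    rw [← norm_eq_zero, q.norm_toCompletion, hq _ (Or.inl (Or.inl (Or.inl ⟨i, i, rfl⟩)))]
  rw [Matrix.sub_apply, Matrix.mul_apply, Matrix.one_apply_eq, map_sub, map_one, map_sum] at hone
  rw [← q.norm_toCompletion]
  refine norm_le_one_of_sum_eq_one (fun k => q.toCompletion (genMatrix N i k)) ?_ j
  rw [← sub_eq_zero.1 hone]
  exact Finset.sum_congr rfl fun k _ => by
    rw [Matrix.conjTranspose_apply, map_mul, map_star]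

/-- `C(O_N^+)`, the universal C⋆-algebra generated by the self-adjoint entries of an orthogonal
`N × N` matrix. -/
abbrev FreeOrthogonal (N : ℕ) : Type :=
  UniversalCStar (freeOrthogonalRelations N) (freeOrthogonal_bounded N)

/-- `C(U_N^+)`, the universal C⋆-algebra generated by the entries of a unitary `N × N` matrix whose
transpose is unitary too. -/
abbrev FreeUnitary (N : ℕ) : Type :=
  UniversalCStar (freeUnitaryRelations N) (freeUnitary_bounded N)

/-- The standard coordinates `u_ij` of `O_N^+`. -/
def FreeOrthogonal.u (N : ℕ) : Matrix (Fin N) (Fin N) (FreeOrthogonal N) :=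
  (genMatrix N).map (UniversalCStar.mk _ (freeOrthogonal_bounded N))

/-- The standard coordinates `u_ij` of `U_N^+`. -/
def FreeUnitary.u (N : ℕ) : Matrix (Fin N) (Fin N) (FreeUnitary N) :=
  (genMatrix N).map (UniversalCStar.mk _ (freeUnitary_bounded N))

/-! ### The twisted half-liberated quantum groups -/

/-- The number of distinct elements among three indices, e.g. the number of rows or of columns
spanned by three coordinates. -/
def spanCard {N : ℕ} (i j k : Fin N) : ℕ := ({i, j, k} : Finset (Fin N)).card

/-- The sign which corresponds to the number `r` of rows and the number `c` of columns spanned by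
three coordinates: `-1` for `(≤ 2, 3)` and `(3, ≤ 2)`, and `1` otherwise. -/
def twistSign (r c : ℕ) : ℂ := if (r ≤ 2 ∧ c = 3) ∨ (r = 3 ∧ c ≤ 2) then -1 else 1

/-- The elements `αβγ ∓ γβα`, where `α = a, a*`, `β = b, b*`, `γ = c, c*`, and where `a, b, c` are
entries of `w`. -/
def twistedHalfRelations {A : Type u} [CStarAlgebra A] {N : ℕ} (w : Matrix (Fin N) (Fin N) A) :
    Set A :=
  {x | ∃ i j k l p q : Fin N, ∃ α β γ : A,
    (α = w i j ∨ α = star (w i j)) ∧ (β = w k l ∨ β = star (w k l)) ∧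
    (γ = w p q ∨ γ = star (w p q)) ∧
    x = α * β * γ - twistSign (spanCard i k p) (spanCard j l q) • (γ * β * α)}

/-- The quotient of a C⋆-algebra by the twisted half-commutation relations between the entries of
the matrix `w`. -/
abbrev TwistedHalf {A : Type u} [CStarAlgebra A] {N : ℕ} (w : Matrix (Fin N) (Fin N) A) : Type u :=
  UniversalCStar (twistedHalfRelations w) (hasBoundedRelations_of_cstarAlgebra _)

/-- The quotient map. -/
def TwistedHalf.mk {A : Type u} [CStarAlgebra A] {N : ℕ} (w : Matrix (Fin N) (Fin N) A) :
    A →⋆ₐ[ℂ] TwistedHalf w :=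
  UniversalCStar.mk (twistedHalfRelations w) (hasBoundedRelations_of_cstarAlgebra _)

/-- The images of the entries of `w` in the quotient. -/
def TwistedHalf.u {A : Type u} [CStarAlgebra A] {N : ℕ} (w : Matrix (Fin N) (Fin N) A) :
    Matrix (Fin N) (Fin N) (TwistedHalf w) :=
  w.map (TwistedHalf.mk w)

end QuantumGroups

end

noncomputable section

universe u v

/-! ### Extension of ⋆-homomorphisms to completions -/

/-! A morphism out of a universal C⋆-algebra is the same as a matrix over the target satisfying the
defining relations. So everything reduces to showing that, when `w` satisfies the relations, so do
the three matrices with entries `∑_k w_ik ⊗ w_kj`, `δ_ij` and `w_ji*`, the last one over the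
opposite algebra.

For the free relations, the first matrix is the product of `w ⊗ 1` and `1 ⊗ w`, whose entries
commute with each other, so the one-sided inverses multiply (`Matrix.map_mul_mul_mul_eq_one`).
Passing to the opposite algebra exchanges the relations for `w` with those for its entrywise adjoint
(`IsFreeUnitary.antipode`).

For the twisted relations the point is the sign. On spans of size at most 3 it is `s(r)s(c)`, with
`s(3) = -1` and `s = 1` otherwise. Hence the signs of the two tensor legs, which share the three
summation indices, multiply to the required sign (`twistSign_mul`, `IsTwistedHalf.comul`). The sign
is trivial on the diagonal, which gives the counit, and symmetric, which gives the antipode. The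
maps `(π ⊗ π)Δ`, `ε` and `πS` therefore kill the twisted relations and descend
(`HopfMaps.exists_descendsTo_twistedHalf`).

Woronowicz's antipode is the restriction of `S` to the coordinate algebra, where `S² = 1`; unitarity
of `w` says that it inverts `w` (`HopfMaps.isCompactMatrixQuantumGroup`). Surjectivity of `π` holds
because a ⋆-homomorphism of C⋆-algebras with dense range is onto: elements of the range have
norm-controlled lifts (`StarAlgHom.exists_norm_le`). -/

theorem StarAlgHom.continuous_of_cstarAlgebra {A : Type u} {B : Type v} [CStarAlgebra A]
    [CStarAlgebra B] (φ : A →⋆ₐ[ℂ] B) : Continuous φ :=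
  AddMonoidHomClass.continuous_of_bound φ 1 fun x => by
    rw [one_mul]
    exact NonUnitalStarAlgHom.norm_apply_le φ x

namespace CStarSeminorm

variable {E : Type u} [Ring E] [StarRing E] [Algebra ℂ E]

/-- The pullback of the norm along a ⋆-homomorphism to a C⋆-algebra. -/
def ofStarAlgHom {B : Type v} [CStarAlgebra B] (φ : E →⋆ₐ[ℂ] B) : CStarSeminorm E where
  toSeminorm := Seminorm.ofSMulLE (fun x => ‖φ x‖) (by rw [map_zero, norm_zero])
    (fun x y => by rw [map_add]; exact norm_add_le _ _)
    (fun c x => by rw [map_smul]; exact norm_smul_le c _)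
  mul_le x y := (congrArg norm (map_mul φ x y)).le.trans (norm_mul_le _ _)
  star_mul_self x := by
    change ‖φ (star x * x)‖ = ‖φ x‖ * ‖φ x‖
    rw [map_mul, map_star, CStarRing.norm_star_mul_self]

theorem ofStarAlgHom_apply {B : Type v} [CStarAlgebra B] (φ : E →⋆ₐ[ℂ] B) (x : E) :
    ofStarAlgHom φ x = ‖φ x‖ := rfl

theorem le_sup {S : Set (CStarSeminorm E)} (hS : ∀ x, ∃ C : ℝ, ∀ q ∈ S, q x ≤ C)
    {q : CStarSeminorm E} (hq : q ∈ S) (x : E) : q x ≤ sup S hS x := by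
  obtain ⟨C, hC⟩ := hS x
  rw [sup_apply]
  exact le_ciSup (f := fun q : S => q.1 x) ⟨C, by rintro _ ⟨q, rfl⟩; exact hC q.1 q.2⟩ ⟨q, hq⟩

/-- The topology is the one of the seminorm `q`, carried by the synonym `q.Carrier`; this is the
continuity needed to extend `φ` to the completion. -/
theorem continuous_of_le (q : CStarSeminorm E) {B : Type v} [CStarAlgebra B] (φ : E →⋆ₐ[ℂ] B)
    (h : ∀ x, ‖φ x‖ ≤ q x) :
    Continuous (show q.Carrier →+* B from (φ : E →ₐ[ℂ] B).toRingHom) :=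
  AddMonoidHomClass.continuous_of_bound
    (show q.Carrier →+* B from (φ : E →ₐ[ℂ] B).toRingHom) 1 fun x => by
      rw [one_mul]
      exact h x

/-- The extension to the completion of a ⋆-homomorphism which is contractive for the given
C⋆-seminorm. -/
def lift (q : CStarSeminorm E) {B : Type v} [CStarAlgebra B] (φ : E →⋆ₐ[ℂ] B)
    (h : ∀ x, ‖φ x‖ ≤ q x) : q.Completion →⋆ₐ[ℂ] B :=
  have hcont := q.continuous_of_le φ h
  let F : q.Completion →+* B := UniformSpace.Completion.extensionHom (α := q.Carrier) _ hcont
  have hF : ∀ x : E, F (q.coe x) = φ x :=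
    UniformSpace.Completion.extensionHom_coe (α := q.Carrier) _ hcont
  have hFc : Continuous F := UniformSpace.Completion.continuous_extension
  { F with
    commutes' := fun c => by
      have hc : algebraMap ℂ q.Completion c = q.coe (algebraMap ℂ E c) :=
        (AlgHomClass.commutes q.toCompletion c).symm
      change F _ = _
      rw [hc, hF, AlgHomClass.commutes]
    map_star' := q.induction (isClosed_eq (hFc.comp q.continuous_star)
        hFc.star) fun x => by
      change F (star (q.coe x)) = star (F (q.coe x))
      rw [← q.coe_star, hF, hF, map_star] }

theorem lift_toCompletion (q : CStarSeminorm E) {B : Type v} [CStarAlgebra B] (φ : E →⋆ₐ[ℂ] B)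
    (h : ∀ x, ‖φ x‖ ≤ q x) (x : E) : q.lift φ h (q.toCompletion x) = φ x :=
  UniformSpace.Completion.extensionHom_coe (α := q.Carrier) _ (q.continuous_of_le φ h) x

end CStarSeminorm

/-! ### The universal property of the C⋆-algebras with given relations -/

namespace UniversalCStar

variable {E : Type u} [Ring E] [StarRing E] [Algebra ℂ E] {R : Set E}
  (hR : HasBoundedRelations E R)

theorem mk_eq_zero {r : E} (hr : r ∈ R) : mk R hR r = 0 := by
  rw [← norm_eq_zero]
  refine (CStarSeminorm.norm_toCompletion _ r).trans ?_
  rw [relationSeminorm_apply]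
  have h : ∀ q : relationSeminorms E R, q.1 r = 0 := fun q => q.2 r hr
  simp only [h]
  -- A real supremum of zeros is zero whatever the index type, so nonemptiness of the set of
  -- seminorms is not needed.
  exact Real.iSup_const_zero

theorem denseRange_mk : DenseRange (mk R hR) := CStarSeminorm.denseRange_toCompletion _

/-- A ⋆-homomorphism to a C⋆-algebra in which the relations hold extends to the universal
C⋆-algebra. -/
def lift {B : Type v} [CStarAlgebra B] (φ : E →⋆ₐ[ℂ] B) (h : ∀ r ∈ R, φ r = 0) :
    UniversalCStar R hR →⋆ₐ[ℂ] B :=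
  (relationSeminorm R hR).lift φ fun x =>
    -- The pullback of the norm of `B` along `φ` is one of the seminorms over which the supremum is
    -- taken.
    CStarSeminorm.le_sup (fun x => hR x) (q := CStarSeminorm.ofStarAlgHom φ)
      (fun r hr => by rw [CStarSeminorm.ofStarAlgHom_apply, h r hr, norm_zero]) x

theorem lift_mk {B : Type v} [CStarAlgebra B] (φ : E →⋆ₐ[ℂ] B) (h : ∀ r ∈ R, φ r = 0) (x : E) :
    lift hR φ h (mk R hR x) = φ x :=
  CStarSeminorm.lift_toCompletion _ _ _ x

end UniversalCStar

/-! ### Free ⋆-algebras -/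

namespace FreeStarAlgebra

variable {I : Type u} {B : Type v} [Ring B] [StarRing B] [Algebra ℂ B] [StarModule ℂ B]

/-- The ⋆-homomorphism with given values on the generators. -/
def lift (f : I → B) : FreeStarAlgebra I →⋆ₐ[ℂ] B :=
  let F : FreeStarAlgebra I →ₐ[ℂ] B :=
    FreeAlgebra.lift ℂ (Sum.elim f fun i => star (f i))
  have hF : ∀ s, F (letter s) = Sum.elim f (fun i => star (f i)) s :=
    FreeAlgebra.lift_ι_apply (R := ℂ) (Sum.elim f fun i => star (f i))
  { F with
    map_star' := fun x => by
      change F (star x) = star (F x)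
      induction x using induction with
      | hc c => rw [star_algebraMap', AlgHom.commutes, AlgHom.commutes, algebraMap_star_comm]
      | hι s => rw [star_letter, hF, hF]; cases s <;> simp
      | hmul x y hx hy => rw [star_mul, map_mul, map_mul, hx, hy, star_mul]
      | hadd x y hx hy => rw [star_add, map_add, map_add, hx, hy, star_add] }

theorem lift_gen (f : I → B) (i : I) : lift f (gen i) = f i :=
  FreeAlgebra.lift_ι_apply (R := ℂ) (Sum.elim f fun i => star (f i)) (Sum.inl i)

theorem mem_of_gen_mem (S : StarSubalgebra ℂ (FreeStarAlgebra I)) (h : ∀ i, gen i ∈ S)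
    (x : FreeStarAlgebra I) : x ∈ S := by
  induction x using induction with
  | hc c => exact algebraMap_mem S c
  | hι s =>
    rcases s with i | i
    · exact h i
    · have := star_mem (h i)
      rwa [show gen i = letter (Sum.inl i) from rfl, star_letter] at this
  | hmul x y hx hy => exact mul_mem hx hy
  | hadd x y hx hy => exact add_mem hx hy

end FreeStarAlgebra

/-! ### Surjectivity of ⋆-homomorphisms with dense range -/

section DenseRange

variable {A : Type u} {B : Type v} [CStarAlgebra A] [CStarAlgebra B] (φ : A →⋆ₐ[ℂ] B)

/-- A self-adjoint element in the range of a ⋆-homomorphism has a lift of norm at most its own. -/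
theorem StarAlgHom.exists_norm_le_of_isSelfAdjoint (a : A) (ha : IsSelfAdjoint (φ a)) :
    ∃ a', φ a' = φ a ∧ ‖a'‖ ≤ ‖φ a‖ := by
  set C := ‖φ a‖ with hC
  -- The real part of `a` has the same image, since `φ a` is self-adjoint.
  set s : A := (2⁻¹ : ℂ) • (a + star a) with hs
  have hsa : IsSelfAdjoint s := by
    rw [isSelfAdjoint_iff, hs, star_smul, star_add, star_star, add_comm]
    simp
  have hφs : φ s = φ a := by
    rw [hs, map_smul, map_add, map_star, ha.star_eq, ← two_smul ℂ (φ a), smul_smul]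
    norm_num
  -- Truncation to `[-C, C]`: it is the identity on the spectrum of `φ a`, so applying it to `s`
  -- shrinks the norm to at most `C` and leaves the image unchanged.
  let f : ℝ → ℝ := fun x => max (-C) (min C x)
  have hf : Continuous f := by fun_prop
  refine ⟨cfc f s, ?_, ?_⟩
  · rw [φ.map_cfc f s hf.continuousOn
      φ.continuous_of_cstarAlgebra hsa (hsa.map φ)]
    rw [hφs]
    conv_rhs => rw [← cfc_id ℝ (φ a) ha]
    refine cfc_congr fun x hx => ?_
    have hx' : ‖x‖ ≤ C := by
      have h1 := spectrum.norm_le_norm_mul_of_mem hx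
      -- The bound of the spectrum by the norm involves `‖1‖`, which is 1 only in a nontrivial
      -- algebra; in the zero algebra the spectrum is empty.
      rcases subsingleton_or_nontrivial B with h | h
      · exact absurd hx (by rw [spectrum.of_subsingleton]; exact Set.notMem_empty x)
      · rwa [CStarRing.norm_one, mul_one] at h1
    rw [Real.norm_eq_abs, abs_le] at hx'
    simp only [f, id]
    rw [min_eq_right hx'.2, max_eq_right hx'.1]
  · refine norm_cfc_le (norm_nonneg _) fun x _ => ?_
    rw [Real.norm_eq_abs, abs_le]
    have := norm_nonneg (φ a)
    exact ⟨le_max_left _ _, max_le (by linarith) (min_le_left _ _)⟩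

/-- The real and imaginary parts are lifted separately, hence the factor 2. Any constant independent
of `a` would do for surjectivity. -/
theorem StarAlgHom.exists_norm_le (a : A) : ∃ a', φ a' = φ a ∧ ‖a'‖ ≤ 2 * ‖φ a‖ := by
  obtain ⟨x, hx, hx'⟩ := φ.exists_norm_le_of_isSelfAdjoint (realPart a : A)
    ((realPart a).2.map φ)
  obtain ⟨y, hy, hy'⟩ := φ.exists_norm_le_of_isSelfAdjoint (imaginaryPart a : A)
    ((imaginaryPart a).2.map φ)
  have h1 : φ (realPart a : A) = (realPart (φ a) : B) := by
    rw [realPart_apply_coe, realPart_apply_coe, ← map_star, ← map_add]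
    exact map_smul (φ.restrictScalars ℝ) _ _
  have h2 : φ (imaginaryPart a : A) = (imaginaryPart (φ a) : B) := by
    rw [imaginaryPart_apply_coe, imaginaryPart_apply_coe, map_smul, ← map_star, ← map_sub]
    refine congrArg _ ?_
    exact map_smul (φ.restrictScalars ℝ) _ _
  refine ⟨x + Complex.I • y, ?_, ?_⟩
  · rw [map_add, map_smul, hx, hy, ← map_smul, ← map_add, realPart_add_I_smul_imaginaryPart]
  · refine (norm_add_le _ _).trans ?_
    rw [norm_smul, Complex.norm_I, one_mul, two_mul]
    refine add_le_add (hx'.trans ?_) (hy'.trans ?_)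
    · rw [h1]; exact realPart.norm_le (φ a)
    · rw [h2]; exact imaginaryPart.norm_le (φ a)

/-- A ⋆-homomorphism of C⋆-algebras with dense range is surjective. -/
theorem StarAlgHom.surjective_of_denseRange (h : DenseRange φ) : Function.Surjective φ := by
  let F : NormedAddGroupHom A B := (φ : A →+ B).mkNormedAddGroupHom 1 fun x => by
    rw [one_mul]
    exact NonUnitalStarAlgHom.norm_apply_le φ x
  have hF : F.SurjectiveOnWith (φ : A →+ B).range 2 := by
    rintro _ ⟨a, rfl⟩
    exact φ.exists_norm_le a
  -- Controlled lifts pass to the closure of the range, by summing a series of lifts in the complete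
  -- space `A`. The slack 1 is arbitrary, as the resulting norm bound is discarded.
  have hF' := controlled_closure_of_complete two_pos one_pos hF
  intro b
  obtain ⟨a, ha, -⟩ := hF' b (h b)
  exact ⟨a, ha⟩

end DenseRange

/-! ### Functoriality of the minimal tensor product -/

section MinTensorMaps

variable {A : Type u} {B : Type v} [CStarAlgebra A] [CStarAlgebra B]

theorem minTmul_mul_minTmul (a a' : A) (b b' : B) :
    minTmul a b * minTmul a' b' = minTmul (a * a') (b * b') := by
  rw [minTmul, minTmul, minTmul, ← map_mul, Algebra.TensorProduct.tmul_mul_tmul]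

theorem star_minTmul (a : A) (b : B) : star (minTmul a b) = minTmul (star a) (star b) := by
  rw [minTmul, minTmul, ← map_star, TensorProduct.star_tmul]

theorem smul_minTmul (c : ℂ) (a : A) (b : B) : minTmul (c • a) b = c • minTmul a b := by
  rw [minTmul, minTmul, ← map_smul, TensorProduct.smul_tmul']

theorem minTmul_smul (c : ℂ) (a : A) (b : B) : minTmul a (c • b) = c • minTmul a b := by
  rw [minTmul, minTmul, ← map_smul, TensorProduct.tmul_smul]

variable (A B) in
/-- The embedding of the first factor into the minimal tensor product. -/
def minInclLeft : A →⋆ₐ[ℂ] MinTensor A B where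
  toAlgHom := ((minSeminorm A B).toCompletion : A ⊗[ℂ] B →ₐ[ℂ] MinTensor A B).comp
    Algebra.TensorProduct.includeLeft
  map_star' a := by
    change minTmul (star a) 1 = star (minTmul a 1)
    rw [star_minTmul, star_one]

variable (A B) in
/-- The embedding of the second factor into the minimal tensor product. -/
def minInclRight : B →⋆ₐ[ℂ] MinTensor A B where
  toAlgHom := ((minSeminorm A B).toCompletion : A ⊗[ℂ] B →ₐ[ℂ] MinTensor A B).comp
    Algebra.TensorProduct.includeRight
  map_star' b := by
    change minTmul 1 (star b) = star (minTmul 1 b)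
    rw [star_minTmul, star_one]

theorem minInclLeft_mul_minInclRight (a : A) (b : B) :
    minInclLeft A B a * minInclRight A B b = minTmul a b := by
  change minTmul a 1 * minTmul 1 b = _
  rw [minTmul_mul_minTmul, mul_one, one_mul]

theorem minInclRight_mul_minInclLeft (a : A) (b : B) :
    minInclRight A B b * minInclLeft A B a = minTmul a b := by
  change minTmul 1 b * minTmul a 1 = _
  rw [minTmul_mul_minTmul, mul_one, one_mul]

variable {A' : Type u} {B' : Type v} [CStarAlgebra A'] [CStarAlgebra B']

/-- The algebraic tensor product of two ⋆-homomorphisms. -/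
def StarAlgHom.tensorMap (φ : A →⋆ₐ[ℂ] A') (ψ : B →⋆ₐ[ℂ] B') : A ⊗[ℂ] B →⋆ₐ[ℂ] A' ⊗[ℂ] B' where
  toAlgHom := Algebra.TensorProduct.map (φ : A →ₐ[ℂ] A') (ψ : B →ₐ[ℂ] B')
  map_star' x := by
    change Algebra.TensorProduct.map (φ : A →ₐ[ℂ] A') (ψ : B →ₐ[ℂ] B') (star x) =
      star (Algebra.TensorProduct.map (φ : A →ₐ[ℂ] A') (ψ : B →ₐ[ℂ] B') x)
    induction x using TensorProduct.induction_on with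
    | zero => simp
    | add x y hx hy => rw [star_add, map_add, map_add, hx, hy, star_add]
    | tmul a b =>
      rw [TensorProduct.star_tmul, Algebra.TensorProduct.map_tmul, Algebra.TensorProduct.map_tmul,
        TensorProduct.star_tmul]
      exact congrArg₂ _ (map_star φ a) (map_star ψ b)

/-- Representations of `A'` and `B'` pull back along `φ` and `ψ` to representations of `A` and `B`
on the same Hilbert spaces. So each seminorm in the supremum on the left occurs in the one on the
right; this is where `A` and `A'`, and likewise `B` and `B'`, must share a universe. -/
theorem minSeminorm_tensorMap_le (φ : A →⋆ₐ[ℂ] A') (ψ : B →⋆ₐ[ℂ] B') (x : A ⊗[ℂ] B) :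
    minSeminorm A' B' (φ.tensorMap ψ x) ≤ minSeminorm A B x := by
  refine Real.iSup_le ?_ ((minSeminorm A B).nonneg x)
  rintro ⟨_, H, _, _, _, K, _, _, _, π, ρ, rfl⟩
  have h : ∀ y, tensorRep π ρ (φ.tensorMap ψ y) = tensorRep (π.comp φ) (ρ.comp ψ) y := fun y => by
    induction y using TensorProduct.induction_on with
    | zero => simp
    | add x y hx hy => rw [map_add, map_add, map_add, hx, hy]
    | tmul a b => rfl
  change ‖tensorRep π ρ (φ.tensorMap ψ x)‖ ≤ _
  rw [h]
  exact CStarSeminorm.le_sup (spatialSeminorms_bounded A B)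
    (q := spatialSeminorm (π.comp φ) (ρ.comp ψ)) ⟨H, _, _, _, K, _, _, _, _, _, rfl⟩ x

/-- The tensor product of two ⋆-homomorphisms, on the minimal tensor products. -/
def minMap (φ : A →⋆ₐ[ℂ] A') (ψ : B →⋆ₐ[ℂ] B') : MinTensor A B →⋆ₐ[ℂ] MinTensor A' B' :=
  (minSeminorm A B).lift ((minSeminorm A' B').toCompletion.comp (φ.tensorMap ψ)) fun x => by
    rw [StarAlgHom.comp_apply, CStarSeminorm.norm_toCompletion]
    exact minSeminorm_tensorMap_le φ ψ x

theorem minMap_minTmul (φ : A →⋆ₐ[ℂ] A') (ψ : B →⋆ₐ[ℂ] B') (a : A) (b : B) :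
    minMap φ ψ (minTmul a b) = minTmul (φ a) (ψ b) :=
  CStarSeminorm.lift_toCompletion _ _ _ _

end MinTensorMaps

/-! ### Opposite C⋆-algebras -/

section Opposite

/-- A ⋆-homomorphism, as a ⋆-homomorphism of the opposite algebras. -/
def StarAlgHom.mulOp {A : Type u} {B : Type v} [CStarAlgebra A] [CStarAlgebra B]
    (φ : A →⋆ₐ[ℂ] B) : Aᵐᵒᵖ →⋆ₐ[ℂ] Bᵐᵒᵖ where
  toAlgHom := AlgHom.op (φ : A →ₐ[ℂ] B)
  map_star' a := congrArg MulOpposite.op (map_star φ (MulOpposite.unop a))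

theorem StarAlgHom.mulOp_apply {A : Type u} {B : Type v} [CStarAlgebra A] [CStarAlgebra B]
    (φ : A →⋆ₐ[ℂ] B) (a : Aᵐᵒᵖ) : φ.mulOp a = MulOpposite.op (φ (MulOpposite.unop a)) := rfl

end Opposite

/-! ### Matrices satisfying the twisted half-commutation relations -/

section Twisted

variable {A : Type u} {B : Type v} [CStarAlgebra A] [CStarAlgebra B] {N : ℕ}

/-- The entry `w i j` or its adjoint. -/
def starEntry {n : Type} (w : Matrix n n A) (s : Bool) (i j : n) : A :=
  if s then star (w i j) else w i j

theorem starEntry_map {n : Type} (φ : A →⋆ₐ[ℂ] B) (w : Matrix n n A) (s : Bool) (i j : n) :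
    starEntry (w.map φ) s i j = φ (starEntry w s i j) := by
  cases s
  · rfl
  · exact (map_star φ (w i j)).symm

/-- The entries of `w` and their adjoints satisfy the twisted half-commutation relations. -/
def IsTwistedHalf (w : Matrix (Fin N) (Fin N) A) : Prop :=
  ∀ (i j k l p q : Fin N) (s t r : Bool),
    starEntry w s i j * starEntry w t k l * starEntry w r p q =
      twistSign (spanCard i k p) (spanCard j l q) •
        (starEntry w r p q * starEntry w t k l * starEntry w s i j)

/-- Puts the hypothesis of `UniversalCStar.lift` in terms of the image matrix alone, so that closure
properties of `IsTwistedHalf` produce morphisms out of the quotient. -/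
theorem isTwistedHalf_map_iff (w : Matrix (Fin N) (Fin N) A) (φ : A →⋆ₐ[ℂ] B) :
    IsTwistedHalf (w.map φ) ↔ ∀ x ∈ twistedHalfRelations w, φ x = 0 := by
  constructor
  · rintro h _ ⟨i, j, k, l, p, q, α, β, γ, hα, hβ, hγ, rfl⟩
    have H : ∀ {a : A} {i j : Fin N}, a = w i j ∨ a = star (w i j) →
        ∃ s, a = starEntry w s i j := by
      rintro a i j (h | h)
      · exact ⟨false, h⟩
      · exact ⟨true, h⟩
    obtain ⟨s, rfl⟩ := H hα
    obtain ⟨t, rfl⟩ := H hβ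
    obtain ⟨r, rfl⟩ := H hγ
    simpa only [map_sub, map_smul, map_mul, starEntry_map, sub_eq_zero] using h i j k l p q s t r
  · intro h i j k l p q s t r
    have H : ∀ (s : Bool) (i j : Fin N),
        starEntry w s i j = w i j ∨ starEntry w s i j = star (w i j) := by
      rintro (_ | _) i j
      · exact Or.inl rfl
      · exact Or.inr rfl
    have := h _ ⟨i, j, k, l, p, q, _, _, _, H s i j, H t k l, H r p q, rfl⟩
    simpa only [map_sub, map_smul, map_mul, starEntry_map, sub_eq_zero] using this

theorem TwistedHalf.isTwistedHalf_u (w : Matrix (Fin N) (Fin N) A) :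
    IsTwistedHalf (TwistedHalf.u w) :=
  (isTwistedHalf_map_iff w (TwistedHalf.mk w)).2 fun _ hx => UniversalCStar.mk_eq_zero _ hx

theorem spanCard_le (i j k : Fin N) : spanCard i j k ≤ 3 := Finset.card_le_three

/-- The sign is -1 exactly when one, and only one, of its arguments equals 3, so it is a product of
one factor per argument and the middle factor squares to 1. The bounds matter: `twistSign 2 3 *
twistSign 3 4` is -1, while `twistSign 2 4` is 1. -/
theorem twistSign_mul {a b c : ℕ} (ha : a ≤ 3) (hb : b ≤ 3) (hc : c ≤ 3) :
    twistSign a b * twistSign b c = twistSign a c := by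
  unfold twistSign
  interval_cases a <;> interval_cases b <;> interval_cases c <;> norm_num

theorem twistSign_self (a : ℕ) : twistSign a a = 1 := if_neg (by omega)

theorem twistSign_comm (a b : ℕ) : twistSign a b = twistSign b a := by
  unfold twistSign
  exact if_congr (by omega) rfl rfl

theorem spanCard_rev (i j k : Fin N) : spanCard i j k = spanCard k j i := by
  unfold spanCard
  congr 1
  ext x
  simp only [Finset.mem_insert, Finset.mem_singleton]
  tauto

theorem Finset.sum_mul_sum_mul_sum {R ι : Type*} [Semiring R] [Fintype ι] (f g h : ι → R) :
    (∑ x, f x) * (∑ y, g y) * (∑ z, h z) = ∑ x, ∑ y, ∑ z, f x * g y * h z := by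
  rw [Finset.sum_mul_sum]
  simp_rw [Finset.sum_mul, Finset.mul_sum]

/-- Expands the reversed product with the summation order of the direct one, so that the two can be
compared term by term. -/
theorem Finset.sum_mul_sum_mul_sum_rev {R ι : Type*} [Semiring R] [Fintype ι] (f g h : ι → R) :
    (∑ z, h z) * (∑ y, g y) * (∑ x, f x) = ∑ x, ∑ y, ∑ z, h z * g y * f x := by
  rw [Finset.sum_mul_sum_mul_sum, Finset.sum_comm_cycle]
  exact Finset.sum_congr rfl fun x _ => Finset.sum_comm

variable {n : Type}

/-- The matrix with entries `∑_k w_ik ⊗ w_kj`. -/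
def comulMatrix [Fintype n] (w : Matrix n n A) : Matrix n n (MinTensor A A) :=
  Matrix.of fun i j => ∑ k, minTmul (w i k) (w k j)

theorem starEntry_comulMatrix [Fintype n] (w : Matrix n n A) (s : Bool) (i j : n) :
    starEntry (comulMatrix w) s i j = ∑ k, minTmul (starEntry w s i k) (starEntry w s k j) := by
  cases s
  · rfl
  · change star (∑ k, minTmul (w i k) (w k j)) = _
    rw [star_sum]
    exact Finset.sum_congr rfl fun k _ => star_minTmul _ _

theorem IsTwistedHalf.comul {w : Matrix (Fin N) (Fin N) A} (hw : IsTwistedHalf w) :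
    IsTwistedHalf (comulMatrix w) := by
  intro i j k l p q s t r
  simp only [starEntry_comulMatrix]
  rw [Finset.sum_mul_sum_mul_sum, Finset.sum_mul_sum_mul_sum_rev]
  simp only [minTmul_mul_minTmul, Finset.smul_sum]
  refine Finset.sum_congr rfl fun x _ => Finset.sum_congr rfl fun y _ =>
    Finset.sum_congr rfl fun z _ => ?_
  -- The columns `x, y, z` of the first leg are the rows of the second, so the sign of their common
  -- span cancels.
  rw [hw i x k y p z s t r, hw x j y l z q s t r, smul_minTmul, minTmul_smul, smul_smul,
    twistSign_mul (spanCard_le _ _ _) (spanCard_le _ _ _) (spanCard_le _ _ _)]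

/-- If a Kronecker delta vanishes, both sides are zero; otherwise the row and column indices
coincide, the two spans are equal, and the sign is 1. -/
theorem IsTwistedHalf.one : IsTwistedHalf (1 : Matrix (Fin N) (Fin N) ℂ) := by
  have hs : ∀ s (i j : Fin N), starEntry (1 : Matrix (Fin N) (Fin N) ℂ) s i j =
      if i = j then 1 else 0 := by
    rintro (_ | _) i j
    · rfl
    · change star ((1 : Matrix (Fin N) (Fin N) ℂ) i j) = _
      rw [Matrix.one_apply]
      split_ifs <;> simp
  intro i j k l p q s t r
  simp only [hs]
  split_ifs with h1 h2 h3 <;> simp_all [twistSign_self]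

/-- The matrix with entries `w_ji*` in the opposite algebra. -/
def antipodeMatrix (w : Matrix n n A) : Matrix n n Aᵐᵒᵖ :=
  Matrix.of fun i j => MulOpposite.op (star (w j i))

theorem starEntry_antipodeMatrix (w : Matrix n n A) (s : Bool) (i j : n) :
    starEntry (antipodeMatrix w) s i j = MulOpposite.op (starEntry w (!s) j i) := by
  cases s
  · rfl
  · change star (MulOpposite.op (star (w j i))) = MulOpposite.op (w j i)
    rw [← MulOpposite.op_star, star_star]

/-- Reversal of products in the opposite algebra turns the relation into that for the transposed
positions in reverse order. Transposing swaps the row and column spans, and the sign is symmetric.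
-/
theorem IsTwistedHalf.antipode {w : Matrix (Fin N) (Fin N) A} (hw : IsTwistedHalf w) :
    IsTwistedHalf (antipodeMatrix w) := by
  intro i j k l p q s t r
  simp only [starEntry_antipodeMatrix, ← MulOpposite.op_mul, ← MulOpposite.op_smul, ← mul_assoc]
  rw [hw q p l k j i, twistSign_comm, spanCard_rev p, spanCard_rev q]

theorem antipodeMatrix_map (w : Matrix n n A) (φ : A →⋆ₐ[ℂ] B) :
    (antipodeMatrix w).map φ.mulOp = antipodeMatrix (w.map φ) :=
  Matrix.ext fun i j => congrArg MulOpposite.op (map_star φ (w j i))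

theorem Matrix.conjTranspose_map_starAlgHom (w : Matrix n n A) (φ : A →⋆ₐ[ℂ] B) :
    (w.map φ).conjTranspose = w.conjTranspose.map φ :=
  Matrix.ext fun i j => (map_star φ (w j i)).symm

theorem coordinateAlgebra_map (w : Matrix n n A) (φ : A →⋆ₐ[ℂ] B) :
    coordinateAlgebra (w.map φ) = (coordinateAlgebra w).map φ := by
  rw [coordinateAlgebra, coordinateAlgebra, StarAlgHom.map_adjoin, ← Set.range_comp]
  rfl

/-! ### Hopf maps on the twisted quotients -/

variable [Fintype n]

theorem comulMatrix_map {B : Type u} [CStarAlgebra B] (w : Matrix n n A) (φ : A →⋆ₐ[ℂ] B) :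
    (comulMatrix w).map (minMap φ φ) = comulMatrix (w.map φ) :=
  Matrix.ext fun _ _ => (map_sum (minMap φ φ) _ _).trans
    (Finset.sum_congr rfl fun _ _ => minMap_minTmul φ φ _ _)

variable [DecidableEq n]

theorem HopfMaps.map_comul {w : Matrix n n A} (D : HopfMaps w) :
    w.map D.comul = comulMatrix w := Matrix.ext D.comul_apply

theorem HopfMaps.map_counit {w : Matrix n n A} (D : HopfMaps w) : w.map D.counit = 1 :=
  Matrix.ext fun i j => (D.counit_apply i j).trans (Matrix.one_apply).symm

theorem HopfMaps.map_antipode {w : Matrix n n A} (D : HopfMaps w) :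
    w.map D.antipode = antipodeMatrix w := Matrix.ext D.antipode_apply

/-- The maps `Δ`, `ε`, `S` descend to the quotient by the twisted half-commutation relations. -/
theorem HopfMaps.exists_descendsTo_twistedHalf {w : Matrix (Fin N) (Fin N) A} (D : HopfMaps w) :
    ∃ D' : HopfMaps (TwistedHalf.u w), D.DescendsTo D' (TwistedHalf.mk w) := by
  have hu := TwistedHalf.isTwistedHalf_u w
  set π := TwistedHalf.mk w
  -- `(π ⊗ π)Δ` sends `w` to the comultiplication matrix of the quotient coordinates, which already
  -- satisfy the twisted relations. `ε` and `πS` are handled likewise.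
  let Δ := UniversalCStar.lift (hasBoundedRelations_of_cstarAlgebra (twistedHalfRelations w))
    ((minMap π π).comp D.comul) ((isTwistedHalf_map_iff _ _).1 (by
      have h : w.map ((minMap π π).comp D.comul) = (w.map D.comul).map (minMap π π) := rfl
      rw [h, D.map_comul, comulMatrix_map]
      exact hu.comul))
  let ε := UniversalCStar.lift (hasBoundedRelations_of_cstarAlgebra (twistedHalfRelations w))
    D.counit ((isTwistedHalf_map_iff _ _).1 (by rw [D.map_counit]; exact IsTwistedHalf.one))
  let S := UniversalCStar.lift (hasBoundedRelations_of_cstarAlgebra (twistedHalfRelations w))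
    (π.mulOp.comp D.antipode) ((isTwistedHalf_map_iff _ _).1 (by
      have h : w.map (π.mulOp.comp D.antipode) = (w.map D.antipode).map π.mulOp := rfl
      rw [h, D.map_antipode, antipodeMatrix_map]
      exact hu.antipode))
  have hΔ : ∀ a, Δ (π a) = minMap π π (D.comul a) := UniversalCStar.lift_mk _ _ _
  have hε : ∀ a, ε (π a) = D.counit a := UniversalCStar.lift_mk _ _ _
  have hS : ∀ a, S (π a) = π.mulOp (D.antipode a) := UniversalCStar.lift_mk _ _ _
  refine ⟨⟨Δ, ε, S, fun i j => ?_, fun i j => ?_, fun i j => ?_⟩,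
    ⟨minMap π π, minMap_minTmul π π, hΔ⟩, hε, hS⟩
  · refine (hΔ (w i j)).trans ?_
    rw [D.comul_apply, map_sum]
    exact Finset.sum_congr rfl fun k _ => minMap_minTmul π π _ _
  · exact (hε (w i j)).trans (D.counit_apply i j)
  · refine (hS (w i j)).trans ?_
    rw [D.antipode_apply, StarAlgHom.mulOp_apply]
    exact congrArg MulOpposite.op (map_star π (w j i))

/-! ### Compact matrix quantum groups from Hopf maps -/

/-- A unitary matrix generating a C⋆-algebra which has the maps `Δ`, `ε`, `S` defines a compact
matrix quantum group. -/
theorem HopfMaps.isCompactMatrixQuantumGroup {w : Matrix n n A} (D : HopfMaps w)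
    (hdense : Dense (coordinateAlgebra w : Set A)) (h1 : w * w.conjTranspose = 1)
    (h2 : w.conjTranspose * w = 1) : IsCompactMatrixQuantumGroup w where
  dense := hdense
  exists_comul := ⟨D.comul, D.comul_apply⟩
  exists_antipode := by
    have hmem : ∀ a ∈ coordinateAlgebra w,
        MulOpposite.unop (D.antipode a) ∈ coordinateAlgebra w := fun a ha => by
      induction ha using StarAlgebra.adjoin_induction with
      | mem x hx =>
        obtain ⟨⟨i, j⟩, rfl⟩ := hx
        rw [D.antipode_apply]
        exact star_mem (mem_coordinateAlgebra w j i)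
      | algebraMap c =>
        rw [AlgHomClass.commutes]
        exact algebraMap_mem _ c
      | add x y _ _ hx hy => rw [map_add]; exact add_mem hx hy
      | mul x y _ _ hx hy => rw [map_mul]; exact mul_mem hy hx
      | star x _ hx => rw [map_star]; exact star_mem hx
    -- `S²` fixes the generators and is multiplicative and ⋆-preserving, hence is the identity on
    -- the algebra they generate.
    have hinv : ∀ a ∈ coordinateAlgebra w,
        MulOpposite.unop (D.antipode (MulOpposite.unop (D.antipode a))) = a := fun a ha => by
      induction ha using StarAlgebra.adjoin_induction with
      | mem x hx =>
        obtain ⟨⟨i, j⟩, rfl⟩ := hx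
        rw [D.antipode_apply, MulOpposite.unop_op, map_star, D.antipode_apply,
          ← MulOpposite.op_star, star_star, MulOpposite.unop_op]
      | algebraMap c =>
        rw [AlgHomClass.commutes, MulOpposite.algebraMap_apply, MulOpposite.unop_op,
          AlgHomClass.commutes, MulOpposite.algebraMap_apply, MulOpposite.unop_op]
      | add x y _ _ hx hy =>
        rw [map_add, MulOpposite.unop_add, map_add, MulOpposite.unop_add, hx, hy]
      | mul x y _ _ hx hy =>
        rw [map_mul, MulOpposite.unop_mul, map_mul, MulOpposite.unop_mul, hx, hy]
      | star x _ hx => rw [map_star, MulOpposite.unop_star, map_star, MulOpposite.unop_star, hx]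
    let κ : coordinateAlgebra w →ₐ[ℂ] (coordinateAlgebra w)ᵐᵒᵖ :=
      { toFun := fun a => MulOpposite.op ⟨MulOpposite.unop (D.antipode a), hmem a a.2⟩
        map_one' := MulOpposite.unop_injective <| Subtype.ext <|
          congrArg MulOpposite.unop (map_one D.antipode)
        map_mul' := fun x y => MulOpposite.unop_injective <| Subtype.ext <|
          congrArg MulOpposite.unop (map_mul D.antipode (x : A) y)
        map_zero' := MulOpposite.unop_injective <| Subtype.ext <|
          congrArg MulOpposite.unop (map_zero D.antipode)
        map_add' := fun x y => MulOpposite.unop_injective <| Subtype.ext <|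
          congrArg MulOpposite.unop (map_add D.antipode (x : A) y)
        commutes' := fun c => MulOpposite.unop_injective <| Subtype.ext <|
          congrArg MulOpposite.unop (AlgHomClass.commutes D.antipode c) }
    have hκ : ∀ a, ((MulOpposite.unop (κ a) : coordinateAlgebra w) : A) =
        MulOpposite.unop (D.antipode a) := fun _ => rfl
    refine ⟨κ, fun a => Subtype.ext ?_, fun i j => Subtype.ext ?_, fun i j => Subtype.ext ?_⟩
    -- As `S` preserves adjoints, the two stars cancel and the identity reduces to `S² = 1`.
    · rw [hκ, StarMemClass.coe_star, hκ, StarMemClass.coe_star, map_star D.antipode (a : A),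
        MulOpposite.unop_star, star_star, hinv a a.2]
    -- The matrix `κ(w)` is the conjugate transpose of `w`, so both inverse identities are
    -- unitarity, read entrywise.
    · have h := congrFun (congrFun h2 i) j
      rw [Matrix.mul_apply, Matrix.one_apply] at h
      rw [AddSubmonoidClass.coe_finsetSum, apply_ite Subtype.val]
      refine Eq.trans (Finset.sum_congr rfl fun k _ => ?_) h
      exact congrArg (· * w k j) (congrArg MulOpposite.unop (D.antipode_apply i k))
    · have h := congrFun (congrFun h1 i) j
      rw [Matrix.mul_apply, Matrix.one_apply] at h
      rw [AddSubmonoidClass.coe_finsetSum, apply_ite Subtype.val]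
      refine Eq.trans (Finset.sum_congr rfl fun k _ => ?_) h
      exact congrArg (w i k * ·) (congrArg MulOpposite.unop (D.antipode_apply k j))

/-- The compact quantum group structure passes to the twisted quotient, for a unitary matrix generating a C⋆-algebra which has the maps `Δ`, `ε`,
`S`. -/
theorem HopfMaps.twistedHalf {w : Matrix (Fin N) (Fin N) A} (D : HopfMaps w)
    (hdense : Dense (coordinateAlgebra w : Set A)) (h1 : w * w.conjTranspose = 1)
    (h2 : w.conjTranspose * w = 1) :
    IsCompactMatrixQuantumGroup w ∧ IsCompactMatrixQuantumGroup (TwistedHalf.u w) ∧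
      Function.Surjective (TwistedHalf.mk w) ∧
      ∃ (D : HopfMaps w) (D' : HopfMaps (TwistedHalf.u w)),
        D.DescendsTo D' (TwistedHalf.mk w) := by
  obtain ⟨D', hD⟩ := D.exists_descendsTo_twistedHalf
  have hsurj : Function.Surjective (TwistedHalf.mk w) :=
    StarAlgHom.surjective_of_denseRange _ (UniversalCStar.denseRange_mk _)
  have hmap : ∀ v : Matrix (Fin N) (Fin N) A, ∀ v', v * v' = 1 →
      v.map (TwistedHalf.mk w) * v'.map (TwistedHalf.mk w) = 1 := fun v v' h => by
    rw [← Matrix.map_mul, h, Matrix.map_one _ (map_zero _) (map_one _)]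
  refine ⟨D.isCompactMatrixQuantumGroup hdense h1 h2,
    D'.isCompactMatrixQuantumGroup ?_ ?_ ?_, hsurj, D, D', hD⟩
  -- The coordinate algebra of the quotient is the image of a dense subalgebra under a continuous
  -- surjection.
  · have h := hsurj.denseRange.dense_image
      (TwistedHalf.mk w).continuous_of_cstarAlgebra hdense
    rwa [← StarSubalgebra.coe_map, ← coordinateAlgebra_map] at h
  · rw [TwistedHalf.u, Matrix.conjTranspose_map_starAlgHom]
    exact hmap _ _ h1
  · rw [TwistedHalf.u, Matrix.conjTranspose_map_starAlgHom]
    exact hmap _ _ h2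

end Twisted

/-! ### Orthogonal and biunitary matrices -/

section Free

variable {A : Type u} [CStarAlgebra A] {n : Type}

theorem entries_sub_eq_zero_iff {E : Type*} [Ring E] [StarRing E] [Algebra ℂ E]
    (φ : E →⋆ₐ[ℂ] A) (M M' : Matrix n n E) :
    (∀ x ∈ entries (M - M'), φ x = 0) ↔ M.map φ = M'.map φ := by
  constructor
  · exact fun h => Matrix.ext fun i j => sub_eq_zero.1 <|
      (map_sub φ (M i j) (M' i j)).symm.trans (h _ ⟨i, j, rfl⟩)
  · rintro h _ ⟨i, j, rfl⟩
    exact (map_sub φ (M i j) (M' i j)).trans (sub_eq_zero.2 (congrFun (congrFun h i) j))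

theorem Matrix.map_star_map {E : Type*} [Ring E] [StarRing E] [Algebra ℂ E] (φ : E →⋆ₐ[ℂ] A)
    (M : Matrix n n E) : (M.map star).map φ = (M.map φ).map star :=
  Matrix.ext fun i j => StarHomClass.map_star φ (M i j)

variable [Fintype n]

theorem comulMatrix_eq_mul (w : Matrix n n A) :
    comulMatrix w = w.map (minInclLeft A A) * w.map (minInclRight A A) :=
  Matrix.ext fun _ _ => Finset.sum_congr rfl fun _ _ => (minInclLeft_mul_minInclRight _ _).symm

/-- Over a noncommutative ring a transpose does not reverse products in general; here it does
because the two tensor legs commute. -/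
theorem transpose_comulMatrix (w : Matrix n n A) :
    (comulMatrix w).transpose =
      w.transpose.map (minInclRight A A) * w.transpose.map (minInclLeft A A) :=
  Matrix.ext fun _ _ => Finset.sum_congr rfl fun _ _ => (minInclRight_mul_minInclLeft _ _).symm

theorem map_star_comulMatrix (w : Matrix n n A) :
    (comulMatrix w).map star = comulMatrix (w.map star) :=
  Matrix.ext fun _ _ => (star_sum _ _).trans (Finset.sum_congr rfl fun _ _ => star_minTmul _ _)

theorem conjTranspose_comulMatrix (w : Matrix n n A) :
    (comulMatrix w).conjTranspose =
      w.conjTranspose.map (minInclRight A A) * w.conjTranspose.map (minInclLeft A A) := by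
  rw [Matrix.conjTranspose, transpose_comulMatrix]
  exact Matrix.ext fun i j => by
    simp only [Matrix.map_apply, Matrix.mul_apply, Matrix.transpose_apply,
      Matrix.conjTranspose_apply, star_sum, minInclRight_mul_minInclLeft, star_minTmul]

variable [DecidableEq n]

/-- The matrix `w` satisfies `w_ij = w_ij*` and `w wᵗ = wᵗ w = 1`. -/
structure IsFreeOrthogonal (w : Matrix n n A) : Prop where
  map_star : w.map star = w
  mul_transpose : w * w.transpose = 1
  transpose_mul : w.transpose * w = 1

/-- The matrix `w` satisfies `w w* = w* w = 1` and `wᵗ w̄ = w̄ wᵗ = 1`. -/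
structure IsFreeUnitary (w : Matrix n n A) : Prop where
  mul_conjTranspose : w * w.conjTranspose = 1
  conjTranspose_mul : w.conjTranspose * w = 1
  transpose_mul_map_star : w.transpose * w.map star = 1
  map_star_mul_transpose : w.map star * w.transpose = 1

/-- The inner pair cancels under `ψ`, then the outer pair under `φ`. With the two leg embeddings in
either order, this gives all the inverse relations for the comultiplication matrix. -/
theorem Matrix.map_mul_mul_mul_eq_one {B : Type v} [CStarAlgebra B] (φ ψ : A →⋆ₐ[ℂ] B)
    {v w : Matrix n n A} (h : v * w = 1) :
    (v.map φ * v.map ψ) * (w.map ψ * w.map φ) = 1 := by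
  have hmap : ∀ θ : A →⋆ₐ[ℂ] B, v.map θ * w.map θ = 1 := fun θ => by
    rw [← Matrix.map_mul, h, Matrix.map_one _ (map_zero _) (map_one _)]
  rw [mul_assoc, ← mul_assoc (v.map ψ), hmap, one_mul, hmap]

theorem IsFreeOrthogonal.comul {w : Matrix n n A} (hw : IsFreeOrthogonal w) :
    IsFreeOrthogonal (comulMatrix w) where
  map_star := by rw [map_star_comulMatrix, hw.map_star]
  mul_transpose := by
    rw [transpose_comulMatrix, comulMatrix_eq_mul]
    exact Matrix.map_mul_mul_mul_eq_one _ _ hw.mul_transpose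
  transpose_mul := by
    rw [transpose_comulMatrix, comulMatrix_eq_mul]
    exact Matrix.map_mul_mul_mul_eq_one _ _ hw.transpose_mul

theorem IsFreeUnitary.comul {w : Matrix n n A} (hw : IsFreeUnitary w) :
    IsFreeUnitary (comulMatrix w) where
  mul_conjTranspose := by
    rw [conjTranspose_comulMatrix, comulMatrix_eq_mul]
    exact Matrix.map_mul_mul_mul_eq_one _ _ hw.mul_conjTranspose
  conjTranspose_mul := by
    rw [conjTranspose_comulMatrix, comulMatrix_eq_mul]
    exact Matrix.map_mul_mul_mul_eq_one _ _ hw.conjTranspose_mul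
  transpose_mul_map_star := by
    rw [transpose_comulMatrix, map_star_comulMatrix, comulMatrix_eq_mul]
    exact Matrix.map_mul_mul_mul_eq_one _ _ hw.transpose_mul_map_star
  map_star_mul_transpose := by
    rw [transpose_comulMatrix, map_star_comulMatrix, comulMatrix_eq_mul]
    exact Matrix.map_mul_mul_mul_eq_one _ _ hw.map_star_mul_transpose

theorem IsFreeOrthogonal.one : IsFreeOrthogonal (1 : Matrix n n A) where
  map_star := Matrix.map_one _ (star_zero _) (star_one _)
  mul_transpose := by rw [Matrix.transpose_one, one_mul]
  transpose_mul := by rw [Matrix.transpose_one, one_mul]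

theorem IsFreeOrthogonal.isFreeUnitary {w : Matrix n n A} (hw : IsFreeOrthogonal w) :
    IsFreeUnitary w := by
  have h : w.conjTranspose = w.transpose := by
    rw [Matrix.conjTranspose, Matrix.transpose_map, hw.map_star]
  constructor
  · rw [h, hw.mul_transpose]
  · rw [h, hw.transpose_mul]
  · rw [hw.map_star, hw.transpose_mul]
  · rw [hw.map_star, hw.mul_transpose]

theorem IsFreeUnitary.one : IsFreeUnitary (1 : Matrix n n A) := IsFreeOrthogonal.one.isFreeUnitary

/-- A product of matrices over the opposite algebra is, up to transposition, the product of the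
transposes in reverse order. Unitarity of the antipode matrix thus amounts to the relations between
`wᵗ` and the entrywise adjoint of `w`, and vice versa: both pairs of relations are needed. -/
theorem IsFreeUnitary.antipode {w : Matrix n n A} (hw : IsFreeUnitary w) :
    IsFreeUnitary (antipodeMatrix w) := by
  have key : ∀ (v v' : Matrix n n Aᵐᵒᵖ) (x x' : Matrix n n A),
      v = x.map MulOpposite.op → v' = x'.map MulOpposite.op →
      x'.transpose * x.transpose = 1 → v * v' = 1 := by
    rintro _ _ x x' rfl rfl h
    ext i j
    have h' := congrArg MulOpposite.op (congrFun (congrFun h j) i)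
    rw [Matrix.mul_apply, ← Matrix.transpose_apply (1 : Matrix n n A), Matrix.transpose_one] at h'
    rw [Matrix.mul_apply]
    refine (Eq.trans ?_ h').trans ?_
    · rw [Finset.op_sum]
      rfl
    · rw [Matrix.one_apply, Matrix.one_apply]
      split_ifs <;> rfl
  have h1 : antipodeMatrix w = w.conjTranspose.map MulOpposite.op := rfl
  have h2 : (antipodeMatrix w).conjTranspose = w.map MulOpposite.op :=
    Matrix.ext fun i j => congrArg MulOpposite.op (star_star (w i j))
  have h3 : (antipodeMatrix w).transpose = (w.map star).map MulOpposite.op := rfl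
  have h4 : (antipodeMatrix w).map star = w.transpose.map MulOpposite.op :=
    Matrix.ext fun i j => congrArg MulOpposite.op (star_star (w j i))
  constructor
  · exact key _ _ _ _ h1 h2 hw.transpose_mul_map_star
  · exact key _ _ _ _ h2 h1 hw.map_star_mul_transpose
  · exact key _ _ _ _ h3 h4 hw.mul_conjTranspose
  · exact key _ _ _ _ h4 h3 hw.conjTranspose_mul

/-- The antipode matrix stays self-adjoint entrywise, so its transpose is its conjugate transpose
and the unitary case applies. -/
theorem IsFreeOrthogonal.antipode {w : Matrix n n A} (hw : IsFreeOrthogonal w) :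
    IsFreeOrthogonal (antipodeMatrix w) := by
  have h := hw.isFreeUnitary.antipode
  have hs : (antipodeMatrix w).map star = antipodeMatrix w :=
    Matrix.ext fun i j => congrArg (fun x : A => MulOpposite.op (star x))
      (congrFun (congrFun hw.map_star j) i)
  have ht : (antipodeMatrix w).conjTranspose = (antipodeMatrix w).transpose := by
    rw [Matrix.conjTranspose, Matrix.transpose_map, hs]
  exact ⟨hs, ht ▸ h.mul_conjTranspose, ht ▸ h.conjTranspose_mul⟩

/-! ### The maps on the free quantum groups -/

variable {N : ℕ}

theorem isFreeOrthogonal_map_iff (φ : FreeStarAlgebra (Fin N × Fin N) →⋆ₐ[ℂ] A) :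
    IsFreeOrthogonal ((genMatrix N).map φ) ↔ ∀ x ∈ freeOrthogonalRelations N, φ x = 0 := by
  simp only [freeOrthogonalRelations, Set.mem_union, or_imp, forall_and, entries_sub_eq_zero_iff,
    Matrix.map_mul, Matrix.map_star_map, Matrix.transpose_map,
    Matrix.map_one _ (map_zero φ) (map_one φ)]
  exact ⟨fun h => ⟨⟨h.1.symm, h.2⟩, h.3⟩, fun h => ⟨h.1.1.symm, h.1.2, h.2⟩⟩

theorem isFreeUnitary_map_iff (φ : FreeStarAlgebra (Fin N × Fin N) →⋆ₐ[ℂ] A) :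
    IsFreeUnitary ((genMatrix N).map φ) ↔ ∀ x ∈ freeUnitaryRelations N, φ x = 0 := by
  have hc : (genMatrix N).conjTranspose.map φ = ((genMatrix N).map φ).conjTranspose := by
    rw [Matrix.conjTranspose, Matrix.conjTranspose, Matrix.map_star_map, Matrix.transpose_map]
  simp only [freeUnitaryRelations, Set.mem_union, or_imp, forall_and, entries_sub_eq_zero_iff,
    Matrix.map_mul, Matrix.map_star_map, Matrix.transpose_map, hc,
    Matrix.map_one _ (map_zero φ) (map_one φ)]
  exact ⟨fun h => ⟨⟨⟨h.1, h.2⟩, h.3⟩, h.4⟩, fun h => ⟨h.1.1.1, h.1.1.2, h.1.2, h.2⟩⟩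

/-- The ⋆-homomorphism of the free ⋆-algebra which maps the generators to the entries of `w`. -/
def evalMatrix (w : Matrix (Fin N) (Fin N) A) : FreeStarAlgebra (Fin N × Fin N) →⋆ₐ[ℂ] A :=
  FreeStarAlgebra.lift fun p => w p.1 p.2

theorem map_evalMatrix (w : Matrix (Fin N) (Fin N) A) : (genMatrix N).map (evalMatrix w) = w :=
  Matrix.ext fun i j => FreeStarAlgebra.lift_gen _ (i, j)

variable {R : Set (FreeStarAlgebra (Fin N × Fin N))}
  (hR : HasBoundedRelations (FreeStarAlgebra (Fin N × Fin N)) R)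

theorem dense_coordinateAlgebra_map_mk :
    Dense (coordinateAlgebra ((genMatrix N).map (UniversalCStar.mk R hR)) :
      Set (UniversalCStar R hR)) := by
  refine (UniversalCStar.denseRange_mk hR).mono ?_
  rintro _ ⟨x, rfl⟩
  -- The preimage of the coordinate algebra is a ⋆-subalgebra containing the free generators, hence
  -- everything.
  exact FreeStarAlgebra.mem_of_gen_mem ((coordinateAlgebra ((genMatrix N).map
    (UniversalCStar.mk R hR))).comap (UniversalCStar.mk R hR))
    (fun p => mem_coordinateAlgebra ((genMatrix N).map (UniversalCStar.mk R hR)) p.1 p.2) x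

theorem UniversalCStar.lift_evalMatrix {w : Matrix (Fin N) (Fin N) A}
    (h : ∀ r ∈ R, evalMatrix w r = 0) (i j : Fin N) :
    lift hR (evalMatrix w) h ((genMatrix N).map (mk R hR) i j) = w i j :=
  (lift_mk hR _ h _).trans (congrFun (congrFun (map_evalMatrix w) i) j)

/-- The maps `Δ`, `ε`, `S` on a universal C⋆-algebra, when the matrices `∑_k u_ik ⊗ u_kj`, `δ_ij`
and `u_ji*` satisfy its relations. -/
def hopfMapsOfRelations
    (hΔ : ∀ r ∈ R, evalMatrix (comulMatrix ((genMatrix N).map (UniversalCStar.mk R hR))) r = 0)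
    (hε : ∀ r ∈ R, evalMatrix (1 : Matrix (Fin N) (Fin N) ℂ) r = 0)
    (hS : ∀ r ∈ R, evalMatrix (antipodeMatrix ((genMatrix N).map (UniversalCStar.mk R hR))) r = 0) :
    HopfMaps ((genMatrix N).map (UniversalCStar.mk R hR)) where
  comul := UniversalCStar.lift hR _ hΔ
  counit := UniversalCStar.lift hR _ hε
  antipode := UniversalCStar.lift hR _ hS
  comul_apply := UniversalCStar.lift_evalMatrix hR hΔ
  counit_apply i j := (UniversalCStar.lift_evalMatrix hR hε i j).trans Matrix.one_apply
  antipode_apply := UniversalCStar.lift_evalMatrix hR hS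

theorem FreeOrthogonal.isFreeOrthogonal_u (N : ℕ) : IsFreeOrthogonal (FreeOrthogonal.u N) :=
  (isFreeOrthogonal_map_iff _).2 fun _ hx => UniversalCStar.mk_eq_zero _ hx

theorem FreeUnitary.isFreeUnitary_u (N : ℕ) : IsFreeUnitary (FreeUnitary.u N) :=
  (isFreeUnitary_map_iff _).2 fun _ hx => UniversalCStar.mk_eq_zero _ hx

theorem evalMatrix_eq_zero_of_isFreeOrthogonal {w : Matrix (Fin N) (Fin N) A}
    (hw : IsFreeOrthogonal w) : ∀ r ∈ freeOrthogonalRelations N, evalMatrix w r = 0 :=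
  (isFreeOrthogonal_map_iff _).1 (by rwa [map_evalMatrix])

theorem evalMatrix_eq_zero_of_isFreeUnitary {w : Matrix (Fin N) (Fin N) A}
    (hw : IsFreeUnitary w) : ∀ r ∈ freeUnitaryRelations N, evalMatrix w r = 0 :=
  (isFreeUnitary_map_iff _).1 (by rwa [map_evalMatrix])

/-- The maps `Δ`, `ε`, `S` on `C(O_N^+)`. -/
def FreeOrthogonal.hopfMaps (N : ℕ) : HopfMaps (FreeOrthogonal.u N) :=
  have hu := FreeOrthogonal.isFreeOrthogonal_u N
  hopfMapsOfRelations (freeOrthogonal_bounded N)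
    (evalMatrix_eq_zero_of_isFreeOrthogonal hu.comul)
    (evalMatrix_eq_zero_of_isFreeOrthogonal IsFreeOrthogonal.one)
    (evalMatrix_eq_zero_of_isFreeOrthogonal hu.antipode)

/-- The maps `Δ`, `ε`, `S` on `C(U_N^+)`. -/
def FreeUnitary.hopfMaps (N : ℕ) : HopfMaps (FreeUnitary.u N) :=
  have hu := FreeUnitary.isFreeUnitary_u N
  hopfMapsOfRelations (freeUnitary_bounded N)
    (evalMatrix_eq_zero_of_isFreeUnitary hu.comul)
    (evalMatrix_eq_zero_of_isFreeUnitary IsFreeUnitary.one)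
    (evalMatrix_eq_zero_of_isFreeUnitary hu.antipode)

end Free

end

theorem proposition3p4 (N : ℕ) :
    (IsCompactMatrixQuantumGroup (FreeOrthogonal.u N) ∧
      IsCompactMatrixQuantumGroup (TwistedHalf.u (FreeOrthogonal.u N)) ∧
      Function.Surjective (TwistedHalf.mk (FreeOrthogonal.u N)) ∧
      ∃ (D : HopfMaps (FreeOrthogonal.u N)) (D' : HopfMaps (TwistedHalf.u (FreeOrthogonal.u N))),
        D.DescendsTo D' (TwistedHalf.mk (FreeOrthogonal.u N))) ∧
    (IsCompactMatrixQuantumGroup (FreeUnitary.u N) ∧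
      IsCompactMatrixQuantumGroup (TwistedHalf.u (FreeUnitary.u N)) ∧
      Function.Surjective (TwistedHalf.mk (FreeUnitary.u N)) ∧
      ∃ (D : HopfMaps (FreeUnitary.u N)) (D' : HopfMaps (TwistedHalf.u (FreeUnitary.u N))),
        D.DescendsTo D' (TwistedHalf.mk (FreeUnitary.u N))) := by
  have hO := (FreeOrthogonal.isFreeOrthogonal_u N).isFreeUnitary
  have hU := FreeUnitary.isFreeUnitary_u N
  exact ⟨(FreeOrthogonal.hopfMaps N).twistedHalf (dense_coordinateAlgebra_map_mk _)
      hO.mul_conjTranspose hO.conjTranspose_mul,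
    (FreeUnitary.hopfMaps N).twistedHalf (dense_coordinateAlgebra_map_mk _)
      hU.mul_conjTranspose hU.conjTranspose_mul⟩
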